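/- All functions are real-valued and $2\pi$-periodic. Put $\|f\|_C=\max_t|f(t)|$ for continuous $f$, $\|f\|_1=\int_{-\pi}^{\pi}|f(t)|\,dt$ and $\|f\|_\infty=\operatorname{ess\,sup}_t|f(t)|$. For $h>0$ and $\beta\in\mathbb{R}$ let $$H_{h,\beta}(t)=\sum_{k=1}^{\infty}\frac{1}{\cosh kh}\cos\Big(kt-\frac{\beta\pi}{2}\Big),\qquad (H_{h,\beta}*\varphi)(x)=\frac1\pi\int_{-\pi}^{\pi}H_{h,\beta}(x-t)\varphi(t)\,dt .$$ For $p\in\{1,\infty\}$ let $C^{h}_{\beta,p}$ be the class of all functions $f=A+H_{h,\beta}*\varphi$ with $A\in\mathbb{R}$, $\varphi\in L_p$, $\|\varphi\|_p\le 1$ and $\int_{-\pi}^{\pi}\varphi(t)\,dt=0$. For a class $\mathfrak N$ of functions in $X=C$ (with norm $\|\cdot\|_C$) or $X=L$ (with norm $\|\cdot\|_1$) let $$E_n(\mathfrak N)_X=\sup_{f\in\mathfrak N}\ \inf_{T\in\mathcal T_{2n-1}}\|f-T\|_X ,$$ where $\mathcal T_{2n-1}$ is the space of trigonometric polynomials of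 degree at most $n-1$. Let $\varphi_n(t)=\operatorname{sign}\sin nt$. Let $n_h^*=1$ if $h\ge\ln\frac{10}{3}$, and if $0<h<\ln\frac{10}{3}$ let $n_h^*$ be the least positive integer $n$ such that $$(1-e^{-h})^2\ \ge\ \frac{5+3e^{-2h}}{1-e^{-2h}}\cdot\frac{\big(\frac{1+e^{-2h}}{2}\big)^{2n}}{\sqrt{1-\big(\frac{1+e^{-2h}}{2}\big)^{2n}}}+(2+e^{-2nh})e^{-2nh}.$$ **Theorem.** Let $h>0$, $\beta\in\mathbb{R}$, and let $n$ be an integer with $n\ge n_h^*$. Then the equation $$\sum_{\nu=0}^{\infty}\frac{1}{\cosh((2\nu+1)nh)}\cos\Big((2\nu+1)\theta\pi-\frac{\beta\pi}{2}\Big)=0$$ has exactly one root $\theta=\theta_n=\theta_n(h,\beta)$ in $[0,1)$, and $$E_n(C^{h}_{\beta,\infty})_C=E_n(C^{h}_{\beta,1})_L=\|H_{h,\beta}*\varphi_n\|_C=\frac4\pi\left|\sum_{\nu=0}^{\infty}\frac{1}{(2\nu+1)\cosh((2\nu+1)nh)}\sin\Big((2\nu+1)\theta_n\pi-\frac{\beta\pi}{2}\Big)\right|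 .$$ -/

import Mathlib

open MeasureTheory Set

noncomputable section

namespace ConvApprox

/-- The kernel `Ψ_β(t) = ∑_{k ≥ 1} ψ(k) cos(k t - β π / 2)`. -/
def kernel (ψ : ℕ → ℝ) (β : ℝ) (t : ℝ) : ℝ :=
  ∑' k : ℕ, ψ (k + 1) * Real.cos (((k + 1 : ℕ) : ℝ) * t - β * Real.pi / 2)

/-- The coefficients `ψ(k) = 1 / cosh (k h)`. -/
def sechCoeff (h : ℝ) (k : ℕ) : ℝ := 1 / Real.cosh ((k : ℝ) * h)

/-- The kernel `H_{h,β}(t) = ∑_{k ≥ 1} cos(k t - β π / 2) / cosh (k h)`. -/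
def kernelH (h β : ℝ) : ℝ → ℝ := kernel (sechCoeff h) β

/-- The convolution `(K ∗ φ)(x) = (1 / π) ∫_{-π}^{π} K(x - t) φ(t) dt`. -/
def conv (K φ : ℝ → ℝ) (x : ℝ) : ℝ :=
  1 / Real.pi * ∫ t in (-Real.pi)..Real.pi, K (x - t) * φ t

/-- Lebesgue measure on one period `(-π, π]`. -/
def periodMeasure : Measure ℝ := volume.restrict (Ioc (-Real.pi) Real.pi)

/-- The class `C^ψ_{β,p}` of functions `f = A + Ψ_β ∗ φ`, where `A` is a real constant and
`φ` is a `2π`-periodic function of `L_p` with `‖φ‖_p ≤ 1` and mean value zero. -/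
def classC (ψ : ℕ → ℝ) (β : ℝ) (p : ENNReal) : Set (ℝ → ℝ) :=
  {f | ∃ (A : ℝ) (φ : ℝ → ℝ),
      Function.Periodic φ (2 * Real.pi) ∧
      MemLp φ p periodMeasure ∧
      eLpNorm φ p periodMeasure ≤ 1 ∧
      (∫ t in (-Real.pi)..Real.pi, φ t) = 0 ∧
      ∀ x, f x = A + conv (kernel ψ β) φ x}

/-- The class `C^h_{β,p}`. -/
def classCh (h β : ℝ) (p : ENNReal) : Set (ℝ → ℝ) := classC (sechCoeff h) β p

/-- The uniform norm `‖f‖_C`, with values in `[0, ∞]`. -/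
def normC (f : ℝ → ℝ) : ENNReal := ⨆ x : ℝ, ‖f x‖ₑ

/-- The norm `‖f‖_1 = ∫_{-π}^{π} |f(t)| dt`, with values in `[0, ∞]`. -/
def normL (f : ℝ → ℝ) : ENNReal := eLpNorm f 1 periodMeasure

/-- For `n ≥ 1`, the space `𝒯_{2n-1}` of real trigonometric polynomials of degree at most
`n - 1`. The term `k = 0` of the sum is the constant one. -/
def trigPoly (n : ℕ) : Set (ℝ → ℝ) :=
  {T | ∃ a b : ℕ → ℝ, ∀ x, T x = ∑ k ∈ Finset.range n,
      (a k * Real.cos ((k : ℝ) * x) + b k * Real.sin ((k : ℝ) * x))}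

/-- The best approximation `E_n(N) = sup_{f ∈ N} inf_{T ∈ 𝒯_{2n-1}} ‖f - T‖` of a class `N` of
functions, for a given norm, with values in `[0, ∞]`. -/
def bestApprox (norm : (ℝ → ℝ) → ENNReal) (N : Set (ℝ → ℝ)) (n : ℕ) : ENNReal :=
  ⨆ f ∈ N, ⨅ T ∈ trigPoly n, norm (fun x => f x - T x)

/-- `φ_n(t) = sign (sin (n t))`. -/
def signSin (n : ℕ) (t : ℝ) : ℝ := Real.sign (Real.sin ((n : ℝ) * t))

/-- The inequality which defines the threshold for small `h`. -/
def thresholdIneq (h : ℝ) (n : ℕ) : Prop :=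
  (5 + 3 * Real.exp (-2 * h)) / (1 - Real.exp (-2 * h)) *
      (((1 + Real.exp (-2 * h)) / 2) ^ (2 * n) /
        Real.sqrt (1 - ((1 + Real.exp (-2 * h)) / 2) ^ (2 * n))) +
      (2 + Real.exp (-2 * (n : ℝ) * h)) * Real.exp (-2 * (n : ℝ) * h)
    ≤ (1 - Real.exp (-h)) ^ 2

/-- The least positive integer which satisfies the inequality; it exists for every `h > 0` by
`exists_thresholdIneq`. -/
def nStarStar (h : ℝ) : ℕ := sInf {n : ℕ | 1 ≤ n ∧ thresholdIneq h n}

/-- The number `n_h^*`. -/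
def nStar (h : ℝ) : ℕ := if Real.log (10 / 3) ≤ h then 1 else nStarStar h

/-- The left-hand side of the equation
`∑_{ν ≥ 0} cos((2ν+1) θ π - β π / 2) / cosh((2ν+1) n h) = 0` for `θ`. -/
def thetaSeries (h β : ℝ) (n : ℕ) (θ : ℝ) : ℝ :=
  ∑' ν : ℕ, 1 / Real.cosh ((2 * (ν : ℝ) + 1) * (n : ℝ) * h) *
    Real.cos ((2 * (ν : ℝ) + 1) * θ * Real.pi - β * Real.pi / 2)

/-- The series
`∑_{ν ≥ 0} sin((2ν+1) θ π - β π / 2) / ((2ν+1) cosh((2ν+1) n h))`. -/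
def valueSeries (h β : ℝ) (n : ℕ) (θ : ℝ) : ℝ :=
  ∑' ν : ℕ, 1 / ((2 * (ν : ℝ) + 1) * Real.cosh ((2 * (ν : ℝ) + 1) * (n : ℝ) * h)) *
    Real.sin ((2 * (ν : ℝ) + 1) * θ * Real.pi - β * Real.pi / 2)

theorem exists_thresholdIneq {h : ℝ} (hh : 0 < h) : ∃ n : ℕ, 1 ≤ n ∧ thresholdIneq h n := by
  have he : Real.exp (-2 * h) < 1 := Real.exp_lt_one_iff.2 (by linarith)
  have he1 : Real.exp (-h) < 1 := Real.exp_lt_one_iff.2 (by linarith)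
  have hp : 0 < Real.exp (-2 * h) := Real.exp_pos _
  have hpow : Filter.Tendsto (fun n : ℕ => ((1 + Real.exp (-2 * h)) / 2) ^ (2 * n))
      Filter.atTop (nhds 0) :=
    (tendsto_pow_atTop_nhds_zero_of_lt_one (by linarith) (by linarith)).comp
      (Filter.tendsto_id.const_mul_atTop' two_pos)
  have hexp : Filter.Tendsto (fun n : ℕ => Real.exp (-2 * (n : ℝ) * h))
      Filter.atTop (nhds 0) := by
    have := tendsto_pow_atTop_nhds_zero_of_lt_one hp.le he
    refine this.congr fun n => ?_
    rw [← Real.exp_nat_mul]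
    congr 1
    ring
  have hs : Filter.Tendsto (fun n : ℕ =>
      Real.sqrt (1 - ((1 + Real.exp (-2 * h)) / 2) ^ (2 * n))) Filter.atTop (nhds 1) := by
    have := (hpow.const_sub 1).sqrt
    simpa using this
  have key := ((hpow.div hs one_ne_zero).const_mul
    ((5 + 3 * Real.exp (-2 * h)) / (1 - Real.exp (-2 * h)))).add ((hexp.const_add 2).mul hexp)
  have hpos : (0 : ℝ) < (1 - Real.exp (-h)) ^ 2 := by
    have : 0 < 1 - Real.exp (-h) := by linarith
    positivity
  have hev := key.eventually_le_const (u := (1 - Real.exp (-h)) ^ 2) (by simpa using hpos)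
  obtain ⟨n, hn, hn1⟩ := (hev.and (Filter.eventually_ge_atTop 1)).exists
  exact ⟨n, hn1, hn⟩

/-- The coefficients are summable, so that the series above converge absolutely. -/
theorem summable_sechCoeff {h : ℝ} (hh : 0 < h) : Summable (sechCoeff h) := by
  have hg : Summable (fun k : ℕ => 2 * Real.exp (-h) ^ k) :=
    (summable_geometric_of_lt_one (Real.exp_pos _).le
      (Real.exp_lt_one_iff.2 (by linarith))).mul_left 2
  refine Summable.of_nonneg_of_le
    (fun k => div_nonneg zero_le_one (Real.cosh_pos _).le) (fun k => ?_) hg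
  rw [sechCoeff, div_le_iff₀ (Real.cosh_pos _), ← Real.exp_nat_mul, Real.cosh_eq]
  have h1 : Real.exp ((k : ℝ) * -h) * Real.exp ((k : ℝ) * h) = 1 := by
    rw [← Real.exp_add]
    simp
  nlinarith [Real.exp_pos ((k : ℝ) * -h), Real.exp_pos (-((k : ℝ) * h))]

end ConvApprox

end

open MeasureTheory Set

noncomputable section

namespace ConvApprox

/-! The argument is Nikolskii's. Suppose that for some trigonometric polynomial `T` of degree below
`n` the difference `K - T` has, up to one global sign, the sign of `sin n(t - y)` (`HasNodes`). As
`φ_n` is orthogonal to such polynomials, `(1/π) ∫ |K - T|` equals `|(K ∗ φ_n)(y)|`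
(`HasNodes.exists_norm_eq`). Approximating `A + K ∗ φ` by `A + T ∗ φ` bounds both best
approximations by this number. Conversely, `G = K ∗ φ_n` changes sign under the shift `π/n`. Hence
it takes the values `± |G(y)|` alternately at `2n` equidistant points, which gives the uniform lower
bound. In the integral metric, testing against `φ_n` reduces the problem to choosing `φ`
concentrated where `|G(-t)|` is nearly maximal.

Nodes come from an explicit interpolation. With `q = e^{-h}`, the expansion `1/cosh kh = 2 ∑ (-1)^m
q^{(2m+1)k}` makes the kernel the real part of a sum of fractions `v/(1-v)`, `v = q^{2m+1} e^{it}`.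
Each fraction is interpolated at the zeros of `sin(nt - θπ)` by a polynomial of degree below `n`
plus a multiple of `cos(nt - θπ)` (`div_one_sub_eq_interpolation`). The total real coefficient of
that cosine is the series defining `θ`, so it vanishes at a root. The remainder is `sin(nt - θπ)`
times `-Im ∑ c_m (1+v)/(1-v)`. For `Q = q^n` one has `c_0` of order `Q` and a tail of order `Q³`.
The root equation makes `Re c_0` as small as the tail, and `(1+v)/(1-v)` has positive real part, so
`Im c_0` decides the sign (`nodeFactor_sign`). The threshold for `n` enters only through the two
bounds on `Q²` in `Admissible`. -/

/-! ### Alternating sums over `2n` equidistant points -/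

/-- The alternating sum of `f` over the `2n` points `x + j π / n` of one period. -/
def altSum (n : ℕ) (f : ℝ → ℝ) (x : ℝ) : ℝ :=
  ∑ j ∈ Finset.range (2 * n), (-1) ^ j * f (x + j * Real.pi / n)

theorem neg_one_pow_mul_cos_shift (n k : ℕ) (hn : n ≠ 0) (b x : ℝ) (j : ℕ) :
    (-1) ^ j * Real.cos (k * (x + j * Real.pi / n) - b) =
      (Complex.exp ((k * x - b : ℝ) * Complex.I) *
        Complex.exp (((k : ℂ) / n + 1) * (Real.pi * Complex.I)) ^ j).re := by
  have hn' : (n : ℂ) ≠ 0 := by exact_mod_cast hn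
  have h1 : Complex.exp ((k * x - b : ℝ) * Complex.I) *
        Complex.exp (((k : ℂ) / n + 1) * (Real.pi * Complex.I)) ^ j =
      ((-1) ^ j : ℝ) * Complex.exp ((k * (x + j * Real.pi / n) - b : ℝ) * Complex.I) := by
    have h2 : (((-1) ^ j : ℝ) : ℂ) = Complex.exp (Real.pi * Complex.I) ^ j := by
      rw [Complex.exp_pi_mul_I]; push_cast; rfl
    rw [h2, ← Complex.exp_nat_mul, ← Complex.exp_nat_mul, ← Complex.exp_add, ← Complex.exp_add]
    congr 1
    push_cast
    field_simp
    ring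
  rw [h1, Complex.re_ofReal_mul, Complex.exp_ofReal_mul_I_re]

theorem altSum_cos_of_odd_mul (n ν : ℕ) (hn : n ≠ 0) (b x : ℝ) :
    altSum n (fun t => Real.cos (((2 * ν + 1) * n : ℕ) * t - b)) x =
      2 * n * Real.cos (((2 * ν + 1) * n : ℕ) * x - b) := by
  have hn' : (n : ℝ) ≠ 0 := by exact_mod_cast hn
  unfold altSum
  rw [Finset.sum_congr rfl (g := fun _ => Real.cos (((2 * ν + 1) * n : ℕ) * x - b))]
  · simp
  · intro j _
    have : (((2 * ν + 1) * n : ℕ) : ℝ) * (x + j * Real.pi / n) - b =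
        (((2 * ν + 1) * n : ℕ) * x - b) + ((2 * ν + 1) * j : ℕ) * Real.pi := by
      push_cast
      field_simp
      ring
    beta_reduce
    rw [this, Real.cos_add_nat_mul_pi, ← mul_assoc, ← pow_add]
    have : Even (j + (2 * ν + 1) * j) := ⟨(ν + 1) * j, by ring⟩
    rw [this.neg_one_pow, one_mul]

/-- The sum is the real part of a geometric sum with ratio `ζ = exp(iπ(k/n + 1))`. This ratio is a
`2n`-th root of unity, and it equals one only when `k` is an odd multiple of `n`. -/
theorem altSum_cos_eq_zero (n k : ℕ) (hn : n ≠ 0) (hk : ∀ ν : ℕ, k ≠ (2 * ν + 1) * n) (b x : ℝ) :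
    altSum n (fun t => Real.cos (k * t - b)) x = 0 := by
  have hn' : (n : ℂ) ≠ 0 := by exact_mod_cast hn
  unfold altSum
  simp only [neg_one_pow_mul_cos_shift n k hn b x]
  rw [← Complex.re_sum, ← Finset.mul_sum]
  set ζ := Complex.exp (((k : ℂ) / n + 1) * (Real.pi * Complex.I)) with hζ
  have h1 : ζ ≠ 1 := by
    intro h
    rw [hζ, Complex.exp_eq_one_iff] at h
    obtain ⟨m, hm⟩ := h
    have hpi : (Real.pi : ℂ) * Complex.I ≠ 0 :=
      mul_ne_zero (by exact_mod_cast Real.pi_ne_zero) Complex.I_ne_zero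
    have h2 : ((k : ℂ) / n + 1) = 2 * m := by
      apply mul_right_cancel₀ hpi
      rw [hm]; ring
    -- If `ζ = 1`, then `k = (2m - 1) n`; positivity of `k + n` gives `m ≥ 1`, so `ν = m - 1` is
    -- excluded by `hk`.
    have h3 : (k : ℤ) + n = 2 * m * n := by
      have : (k : ℂ) + n = 2 * m * n := by
        rw [← h2]; field_simp
      exact_mod_cast this
    have hm1 : 1 ≤ m := by
      by_contra hlt
      have : m ≤ 0 := by omega
      have hnpos : 0 < (n : ℤ) := by omega
      nlinarith
    obtain ⟨ν, rfl⟩ : ∃ ν : ℕ, m = ν + 1 := ⟨(m - 1).toNat, by omega⟩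
    apply hk ν
    zify
    linarith
  have h2 : ζ ^ (2 * n) = 1 := by
    rw [hζ, ← Complex.exp_nat_mul, Complex.exp_eq_one_iff]
    refine ⟨k + n, ?_⟩
    push_cast
    field_simp
  rw [geom_sum_eq h1, h2]
  simp

theorem altSum_trigPoly {n : ℕ} (hn : n ≠ 0) {T : ℝ → ℝ} (hT : T ∈ trigPoly n) (x : ℝ) :
    altSum n T x = 0 := by
  obtain ⟨a, b, hT⟩ := hT
  have key : ∀ k ∈ Finset.range n, ∀ c : ℝ,
      altSum n (fun t => Real.cos (k * t - c)) x = 0 := fun k hk c =>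
    altSum_cos_eq_zero n k hn (fun ν h => by
      have : n ≤ (2 * ν + 1) * n := Nat.le_mul_of_pos_left _ (by omega)
      have := Finset.mem_range.1 hk
      omega) c x
  have h1 : altSum n T x = ∑ k ∈ Finset.range n,
      (a k * altSum n (fun t => Real.cos (k * t - 0)) x +
        b k * altSum n (fun t => Real.cos (k * t - Real.pi / 2)) x) := by
    unfold altSum
    simp only [hT, Finset.mul_sum, ← Finset.sum_add_distrib]
    rw [Finset.sum_comm]
    refine Finset.sum_congr rfl fun k _ => Finset.sum_congr rfl fun j _ => ?_
    rw [Real.cos_sub_pi_div_two, sub_zero]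
    ring
  rw [h1]
  exact Finset.sum_eq_zero fun k hk => by rw [key k hk, key k hk]; simp

/-! ### The square wave `φ_n` -/

theorem signSin_shift (n : ℕ) (hn : n ≠ 0) (j : ℕ) (t : ℝ) :
    signSin n (t + j * Real.pi / n) = (-1) ^ j * signSin n t := by
  have hn' : (n : ℝ) ≠ 0 := by exact_mod_cast hn
  unfold signSin
  have : (n : ℝ) * (t + j * Real.pi / n) = n * t + j * Real.pi := by field_simp
  rw [this, Real.sin_add_nat_mul_pi]
  rcases neg_one_pow_eq_or ℝ j with h | h <;> simp [h, Real.sign_neg]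

theorem signSin_eq_one {n : ℕ} {t : ℝ} (h0 : 0 < t) (h1 : t < Real.pi / n) :
    signSin n t = 1 := by
  have hn : 0 < (n : ℝ) := by
    by_contra h
    have : n = 0 := by
      have : (n : ℝ) = 0 := le_antisymm (not_lt.1 h) (Nat.cast_nonneg n)
      exact_mod_cast this
    subst this
    simp at h1
    linarith
  refine Real.sign_of_pos (Real.sin_pos_of_pos_of_lt_pi (by positivity) ?_)
  rw [lt_div_iff₀ hn] at h1
  linarith

theorem signSin_periodic (n : ℕ) : Function.Periodic (signSin n) (2 * Real.pi) := by
  intro t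
  unfold signSin
  have : (n : ℝ) * (t + 2 * Real.pi) = n * t + n * (2 * Real.pi) := by ring
  rw [this, Real.sin_add_nat_mul_two_pi]

theorem measurable_signSin (n : ℕ) : Measurable (signSin n) := by
  have : signSin n = fun t => if Real.sin (n * t) < 0 then (-1 : ℝ) else
      if 0 < Real.sin (n * t) then 1 else 0 := by
    funext t; rfl
  rw [this]
  have hm : Measurable fun t : ℝ => Real.sin (n * t) := by fun_prop
  exact Measurable.ite (measurableSet_lt hm measurable_const) measurable_const
    (Measurable.ite (measurableSet_lt measurable_const hm) measurable_const measurable_const)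

theorem abs_signSin_le (n : ℕ) (t : ℝ) : |signSin n t| ≤ 1 := by
  unfold signSin
  rcases Real.sign_apply_eq (Real.sin (n * t)) with h | h | h <;> simp [h]

theorem intervalIntegrable_mul_signSin {f : ℝ → ℝ} (hf : Continuous f) (n : ℕ) (a b : ℝ) :
    IntervalIntegrable (fun t => f t * signSin n t) volume a b := by
  refine (hf.abs.intervalIntegrable a b).mono_fun
    (hf.measurable.mul (measurable_signSin n)).aestronglyMeasurable ?_
  refine Filter.Eventually.of_forall fun t => ?_
  simp only [Real.norm_eq_abs, abs_mul, abs_abs]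
  exact mul_le_of_le_one_right (abs_nonneg _) (abs_signSin_le n t)

/-- Cutting a period into `2n` intervals of length `π/n`, on which `φ_n` is alternately `1` and
`-1`, folds the integral onto one interval. Thus orthogonality to polynomials and the value of `K ∗
φ_n` both reduce to alternating sums. -/
theorem integral_mul_signSin {f : ℝ → ℝ} (hf : Continuous f)
    (hp : Function.Periodic f (2 * Real.pi)) (n : ℕ) (hn : n ≠ 0) :
    ∫ t in (-Real.pi)..Real.pi, f t * signSin n t =
      ∫ t in (0 : ℝ)..(Real.pi / n), altSum n f t := by
  have hn' : (n : ℝ) ≠ 0 := by exact_mod_cast hn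
  have hper : Function.Periodic (fun t => f t * signSin n t) (2 * Real.pi) := fun t => by
    simp only [hp t, signSin_periodic n t]
  have h1 := hper.intervalIntegral_add_eq (-Real.pi) 0
  rw [show -Real.pi + 2 * Real.pi = Real.pi by ring, zero_add] at h1
  have h2 := intervalIntegral.sum_integral_adjacent_intervals (μ := volume)
    (f := fun t => f t * signSin n t) (a := fun j : ℕ => j * Real.pi / n) (n := 2 * n)
    (fun j _ => intervalIntegrable_mul_signSin hf n _ _)
  have e0 : ((0 : ℕ) : ℝ) * Real.pi / n = 0 := by simp
  have e1 : ((2 * n : ℕ) : ℝ) * Real.pi / n = 2 * Real.pi := by push_cast; field_simp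
  simp only [e0, e1] at h2
  rw [h1, ← h2]
  unfold altSum
  rw [intervalIntegral.integral_finsetSum]
  · refine Finset.sum_congr rfl fun j _ => ?_
    have h3 := intervalIntegral.integral_comp_add_right (a := 0) (b := Real.pi / n)
      (fun t => f t * signSin n t) (j * Real.pi / n)
    have e2 : Real.pi / n + j * Real.pi / n = ((j + 1 : ℕ) : ℝ) * Real.pi / n := by
      push_cast; ring
    rw [zero_add, e2] at h3
    rw [← h3]
    refine intervalIntegral.integral_congr_Ioo_of_le (by positivity) fun t ht => ?_
    rw [signSin_shift n hn, signSin_eq_one ht.1 ht.2]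
    ring
  · intro j _
    exact Continuous.intervalIntegrable (by fun_prop) _ _

/-! ### Integrals over a period and convolutions -/

theorem intervalIntegral_eq_integral_periodMeasure (f : ℝ → ℝ) :
    ∫ t in (-Real.pi)..Real.pi, f t = ∫ t, f t ∂periodMeasure :=
  intervalIntegral.integral_of_le (by linarith [Real.pi_pos])

instance : IsFiniteMeasure periodMeasure := by
  unfold periodMeasure; infer_instance

theorem integral_comp_sub_of_periodic {f : ℝ → ℝ} (hp : Function.Periodic f (2 * Real.pi))
    (x : ℝ) : ∫ t, f (x - t) ∂periodMeasure = ∫ t, f t ∂periodMeasure := by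
  rw [← intervalIntegral_eq_integral_periodMeasure, ← intervalIntegral_eq_integral_periodMeasure,
    intervalIntegral.integral_comp_sub_left f x]
  have := hp.intervalIntegral_add_eq (x - Real.pi) (-Real.pi)
  rw [show x - Real.pi + 2 * Real.pi = x - -Real.pi by ring,
    show -Real.pi + 2 * Real.pi = Real.pi by ring] at this
  exact this

theorem integral_comp_sub_right_of_periodic {f : ℝ → ℝ} (hp : Function.Periodic f (2 * Real.pi))
    (x : ℝ) : ∫ t, f (t - x) ∂periodMeasure = ∫ t, f t ∂periodMeasure := by
  rw [← intervalIntegral_eq_integral_periodMeasure, ← intervalIntegral_eq_integral_periodMeasure,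
    intervalIntegral.integral_comp_sub_right f x]
  have := hp.intervalIntegral_add_eq (-Real.pi - x) (-Real.pi)
  rw [show -Real.pi - x + 2 * Real.pi = Real.pi - x by ring,
    show -Real.pi + 2 * Real.pi = Real.pi by ring] at this
  exact this

theorem integrable_periodMeasure_of_continuous {f : ℝ → ℝ} (hf : Continuous f) :
    Integrable f periodMeasure :=
  (intervalIntegrable_iff_integrableOn_Ioc_of_le (by linarith [Real.pi_pos])).1
    (hf.intervalIntegrable (-Real.pi) Real.pi)

theorem conv_eq (K φ : ℝ → ℝ) (x : ℝ) :
    conv K φ x = 1 / Real.pi * ∫ t, K (x - t) * φ t ∂periodMeasure := by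
  rw [conv, intervalIntegral_eq_integral_periodMeasure]

theorem exists_bound_of_periodic {K : ℝ → ℝ} (hK : Continuous K)
    (hp : Function.Periodic K (2 * Real.pi)) : ∃ C, ∀ t, |K t| ≤ C := by
  have hc := hp.compact_of_continuous (by positivity) hK
  obtain ⟨C, hC⟩ := hc.isBounded.exists_norm_le
  exact ⟨C, fun t => hC _ (mem_range_self t)⟩

theorem integrable_kernel_mul {K φ : ℝ → ℝ} (hK : Continuous K)
    (hp : Function.Periodic K (2 * Real.pi)) (hφ : Integrable φ periodMeasure) (x : ℝ) :
    Integrable (fun t => K (x - t) * φ t) periodMeasure := by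
  obtain ⟨C, hC⟩ := exists_bound_of_periodic hK hp
  exact hφ.bdd_mul (c := C) (by fun_prop) (Filter.Eventually.of_forall fun t => hC _)

theorem continuous_of_mem_trigPoly {n : ℕ} {T : ℝ → ℝ} (hT : T ∈ trigPoly n) : Continuous T := by
  obtain ⟨a, b, hT⟩ := hT
  rw [funext hT]
  fun_prop

theorem periodic_of_mem_trigPoly {n : ℕ} {T : ℝ → ℝ} (hT : T ∈ trigPoly n) :
    Function.Periodic T (2 * Real.pi) := by
  obtain ⟨a, b, hT⟩ := hT
  intro x
  rw [hT, hT]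
  refine Finset.sum_congr rfl fun k _ => ?_
  rw [show (k : ℝ) * (x + 2 * Real.pi) = k * x + k * (2 * Real.pi) by ring,
    Real.cos_add_nat_mul_two_pi, Real.sin_add_nat_mul_two_pi]

theorem const_add_mem_trigPoly {n : ℕ} (hn : n ≠ 0) {T : ℝ → ℝ} (hT : T ∈ trigPoly n) (A : ℝ) :
    (fun x => A + T x) ∈ trigPoly n := by
  obtain ⟨a, b, hT⟩ := hT
  refine ⟨fun k => (if k = 0 then A else 0) + a k, b, fun x => ?_⟩
  simp only [hT, add_mul, add_assoc, Finset.sum_add_distrib, ite_mul, zero_mul]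
  rw [Finset.sum_ite_eq' (Finset.range n) 0 (fun k : ℕ => A * Real.cos (k * x))]
  simp [Nat.pos_of_ne_zero hn]

theorem conv_mem_trigPoly {n : ℕ} {T φ : ℝ → ℝ} (hT : T ∈ trigPoly n)
    (hφ : Integrable φ periodMeasure) : conv T φ ∈ trigPoly n := by
  obtain ⟨a, b, hT⟩ := hT
  have hc : ∀ k : ℕ, Integrable (fun t => Real.cos (k * t) * φ t) periodMeasure := fun k =>
    hφ.bdd_mul (c := 1) (by fun_prop)
      (Filter.Eventually.of_forall fun t => Real.abs_cos_le_one _)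
  have hs : ∀ k : ℕ, Integrable (fun t => Real.sin (k * t) * φ t) periodMeasure := fun k =>
    hφ.bdd_mul (c := 1) (by fun_prop)
      (Filter.Eventually.of_forall fun t => Real.abs_sin_le_one _)
  set I := fun k : ℕ => ∫ t, Real.cos (k * t) * φ t ∂periodMeasure
  set J := fun k : ℕ => ∫ t, Real.sin (k * t) * φ t ∂periodMeasure
  refine ⟨fun k => 1 / Real.pi * (a k * I k - b k * J k),
    fun k => 1 / Real.pi * (a k * J k + b k * I k), fun x => ?_⟩
  have h1 : ∀ t, T (x - t) * φ t = ∑ k ∈ Finset.range n,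
      ((a k * Real.cos (k * x) + b k * Real.sin (k * x)) * (Real.cos (k * t) * φ t) +
       (a k * Real.sin (k * x) - b k * Real.cos (k * x)) * (Real.sin (k * t) * φ t)) := fun t => by
    rw [hT, Finset.sum_mul]
    refine Finset.sum_congr rfl fun k _ => ?_
    rw [mul_sub, Real.cos_sub, Real.sin_sub]
    ring
  rw [conv_eq, integral_congr_ae (Filter.Eventually.of_forall h1), integral_finsetSum]
  · rw [Finset.mul_sum]
    refine Finset.sum_congr rfl fun k _ => ?_
    rw [integral_add ((hc k).const_mul _) ((hs k).const_mul _), integral_const_mul,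
      integral_const_mul]
    simp only [I, J]
    ring
  · intro k _
    exact ((hc k).const_mul _).add ((hs k).const_mul _)

theorem conv_sub {K T φ : ℝ → ℝ} (hK : Continuous K) (hKp : Function.Periodic K (2 * Real.pi))
    (hT : Continuous T) (hTp : Function.Periodic T (2 * Real.pi))
    (hφ : Integrable φ periodMeasure) (x : ℝ) :
    conv (fun t => K t - T t) φ x = conv K φ x - conv T φ x := by
  rw [conv_eq, conv_eq, conv_eq, ← mul_sub, ← integral_sub
    (integrable_kernel_mul hK hKp hφ x) (integrable_kernel_mul hT hTp hφ x)]
  simp only [sub_mul]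

theorem integral_trigPoly_mul_signSin {n : ℕ} (hn : n ≠ 0) {T : ℝ → ℝ} (hT : T ∈ trigPoly n) :
    ∫ t, T t * signSin n t ∂periodMeasure = 0 := by
  rw [← intervalIntegral_eq_integral_periodMeasure, integral_mul_signSin
    (continuous_of_mem_trigPoly hT) (periodic_of_mem_trigPoly hT) n hn]
  simp [altSum_trigPoly hn hT]

/-- Reflection sends `j` to `2n - j`, which has the same parity. The term `j = 0` is its own image
and is split off. -/
theorem altSum_comp_sub (n : ℕ) (hn : n ≠ 0) {f : ℝ → ℝ} (hp : Function.Periodic f (2 * Real.pi))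
    (x t : ℝ) : altSum n (fun s => f (x - s)) t = altSum n f (x - t) := by
  have hn' : (n : ℝ) ≠ 0 := by exact_mod_cast hn
  unfold altSum
  obtain ⟨N, hN⟩ : ∃ N, 2 * n = N + 1 := ⟨2 * n - 1, by omega⟩
  rw [hN, Finset.sum_range_succ', Finset.sum_range_succ', ← Finset.sum_range_reflect]
  congr 1
  · refine Finset.sum_congr rfl fun j hj => ?_
    have hj' := Finset.mem_range.1 hj
    obtain ⟨i, hi⟩ : ∃ i, N - 1 - j = i := ⟨_, rfl⟩
    have hij : i + 1 + (j + 1) = 2 * n := by omega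
    rw [hi]
    have hpow : (-1 : ℝ) ^ (i + 1) = (-1) ^ (j + 1) := by
      have h2 : (-1 : ℝ) ^ (i + 1) * (-1) ^ (j + 1) = 1 := by
        rw [← pow_add, hij, pow_mul]; simp
      rcases neg_one_pow_eq_or ℝ (i + 1) with h | h <;>
        rcases neg_one_pow_eq_or ℝ (j + 1) with h' | h' <;> rw [h, h'] at h2 ⊢ <;> norm_num at h2
    beta_reduce
    rw [hpow, ← hp (x - (t + ((i + 1 : ℕ) : ℝ) * Real.pi / n))]
    congr 2
    have : ((i + 1 : ℕ) : ℝ) = 2 * n - ((j + 1 : ℕ) : ℝ) := by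
      rw [eq_sub_iff_add_eq]; exact_mod_cast hij
    rw [this]
    field_simp
    ring
  · simp

theorem conv_signSin {K : ℝ → ℝ} (hK : Continuous K) (hp : Function.Periodic K (2 * Real.pi))
    {n : ℕ} (hn : n ≠ 0) (x : ℝ) :
    conv K (signSin n) x = 1 / Real.pi * ∫ t in (0 : ℝ)..(Real.pi / n), altSum n K (x - t) := by
  rw [conv, integral_mul_signSin (f := fun t => K (x - t)) (by fun_prop) _ n hn]
  · simp only [altSum_comp_sub n hn hp]
  · intro t
    simp only
    rw [← hp (x - (t + 2 * Real.pi))]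
    congr 1; ring

theorem continuous_altSum {K : ℝ → ℝ} (hK : Continuous K) (n : ℕ) : Continuous (altSum n K) := by
  unfold altSum
  fun_prop

theorem continuous_conv_signSin {K : ℝ → ℝ} (hK : Continuous K)
    (hp : Function.Periodic K (2 * Real.pi)) {n : ℕ} (hn : n ≠ 0) :
    Continuous (conv K (signSin n)) := by
  rw [funext (conv_signSin hK hp hn)]
  refine continuous_const.mul ?_
  have := continuous_altSum hK n
  exact intervalIntegral.continuous_parametric_intervalIntegral_of_continuous' (by fun_prop) _ _

theorem altSum_shift (n : ℕ) (hn : n ≠ 0) {f : ℝ → ℝ} (hp : Function.Periodic f (2 * Real.pi))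
    (x : ℝ) : altSum n f (x + Real.pi / n) = -altSum n f x := by
  have hn' : (n : ℝ) ≠ 0 := by exact_mod_cast hn
  -- The sum over `2n + 1` points is split at either end: the extra point `x + 2π` carries the sign
  -- `+1` and cancels the term `j = 0`.
  have h1 := Finset.sum_range_succ' (fun j : ℕ => (-1 : ℝ) ^ j * f (x + j * Real.pi / n)) (2 * n)
  rw [Finset.sum_range_succ] at h1
  have h2 : f (x + ((2 * n : ℕ) : ℝ) * Real.pi / n) = f x := by
    rw [← hp x]
    congr 2
    push_cast
    field_simp
  have h3 : (-1 : ℝ) ^ (2 * n) = 1 := by rw [pow_mul]; simp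
  rw [h2, h3] at h1
  simp only [pow_zero, Nat.cast_zero, zero_mul, zero_div, add_zero, add_left_inj] at h1
  unfold altSum
  rw [h1, ← Finset.sum_neg_distrib]
  refine Finset.sum_congr rfl fun j _ => ?_
  rw [show x + Real.pi / n + j * Real.pi / n = x + ((j + 1 : ℕ) : ℝ) * Real.pi / n by
    push_cast; ring]
  ring

theorem conv_signSin_shift {K : ℝ → ℝ} (hK : Continuous K)
    (hp : Function.Periodic K (2 * Real.pi)) {n : ℕ} (hn : n ≠ 0) (x : ℝ) :
    conv K (signSin n) (x + Real.pi / n) = -conv K (signSin n) x := by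
  rw [conv_signSin hK hp hn, conv_signSin hK hp hn, ← mul_neg, ← intervalIntegral.integral_neg]
  congr 2
  funext t
  rw [← altSum_shift n hn hp]
  congr 1; ring

theorem conv_signSin_shift_nat {K : ℝ → ℝ} (hK : Continuous K)
    (hp : Function.Periodic K (2 * Real.pi)) {n : ℕ} (hn : n ≠ 0) (x : ℝ) (j : ℕ) :
    conv K (signSin n) (x + j * Real.pi / n) = (-1) ^ j * conv K (signSin n) x := by
  induction j with
  | zero => simp
  | succ j ih =>
    rw [show x + ((j + 1 : ℕ) : ℝ) * Real.pi / n = x + j * Real.pi / n + Real.pi / n by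
      push_cast; ring, conv_signSin_shift hK hp hn, ih]
    ring

theorem memLp_signSin (n : ℕ) : MemLp (signSin n) ⊤ periodMeasure :=
  memLp_top_of_bound (measurable_signSin n).aestronglyMeasurable 1
    (Filter.Eventually.of_forall (abs_signSin_le n))

theorem integrable_signSin (n : ℕ) : Integrable (signSin n) periodMeasure :=
  (memLp_signSin n).integrable le_top

theorem integral_signSin {n : ℕ} (hn : n ≠ 0) : ∫ t, signSin n t ∂periodMeasure = 0 := by
  have h : (fun _ : ℝ => (1 : ℝ)) ∈ trigPoly n := by
    have h0 : (fun _ : ℝ => (0 : ℝ)) ∈ trigPoly n := ⟨0, 0, by simp⟩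
    simpa using const_add_mem_trigPoly hn h0 1
  simpa using integral_trigPoly_mul_signSin hn h

theorem conv_trigPoly_signSin {n : ℕ} (hn : n ≠ 0) {T : ℝ → ℝ} (hT : T ∈ trigPoly n) (x : ℝ) :
    conv T (signSin n) x = 0 := by
  rw [conv_signSin (continuous_of_mem_trigPoly hT) (periodic_of_mem_trigPoly hT) hn]
  simp [altSum_trigPoly hn hT]

theorem conv_signSin_mem_class {ψ : ℕ → ℝ} {β : ℝ} {n : ℕ} (hn : n ≠ 0) :
    conv (kernel ψ β) (signSin n) ∈ classC ψ β ⊤ := by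
  refine ⟨0, signSin n, signSin_periodic n, memLp_signSin n, ?_, ?_, by simp⟩
  · simpa using eLpNorm_le_of_ae_bound (p := ⊤) (μ := periodMeasure) (f := signSin n) (C := 1)
      (Filter.Eventually.of_forall (abs_signSin_le n))
  · rw [intervalIntegral_eq_integral_periodMeasure, integral_signSin hn]

/-! ### Duality for a kernel with nodes: the uniform metric -/

/-- The function `K` has a trigonometric polynomial `T` of degree less than `n` for which `K - T`
has the sign of `± sin (n (t - y))`. -/
def HasNodes (K : ℝ → ℝ) (n : ℕ) (y : ℝ) : Prop :=
  ∃ T ∈ trigPoly n, ∃ D : ℝ → ℝ, (∀ t, K t - T t = Real.sin (n * (t - y)) * D t) ∧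
    ((∀ t, 0 ≤ D t) ∨ ∀ t, D t ≤ 0)

/-- `K - T` times a translate of `φ_n` has constant sign, so the modulus can be taken outside the
integral; `T` then drops out by orthogonality. -/
theorem HasNodes.exists_norm_eq {K : ℝ → ℝ} (hK : Continuous K)
    (hp : Function.Periodic K (2 * Real.pi)) {n : ℕ} (hn : n ≠ 0) {y : ℝ} (h : HasNodes K n y) :
    ∃ T ∈ trigPoly n,
      1 / Real.pi * ∫ t, |K t - T t| ∂periodMeasure = |conv K (signSin n) y| := by
  obtain ⟨T, hT, D, hD, hsign⟩ := h
  refine ⟨T, hT, ?_⟩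
  have hTc := continuous_of_mem_trigPoly hT
  have hTp := periodic_of_mem_trigPoly hT
  have h1 := conv_sub hK hp hTc hTp (integrable_signSin n) y
  rw [conv_trigPoly_signSin hn hT, sub_zero] at h1
  have hRp : Function.Periodic (fun t => |K t - T t|) (2 * Real.pi) := fun t => by
    simp only [hp t, hTp t]
  rw [← h1, conv_eq, abs_mul, abs_of_pos (by positivity : 0 < 1 / Real.pi),
    ← integral_comp_sub_of_periodic hRp y]
  congr 1
  have h2 : ∀ t, (K (y - t) - T (y - t)) * signSin n t = -(|Real.sin (n * t)| * D (y - t)) :=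
    fun t => by
    have hs : Real.sin (n * t) * signSin n t = |Real.sin (n * t)| := by
      unfold signSin
      rcases lt_trichotomy (Real.sin (n * t)) 0 with h | h | h
      · rw [Real.sign_of_neg h, abs_of_neg h]; ring
      · simp [h]
      · rw [Real.sign_of_pos h, abs_of_pos h]; ring
    rw [hD, show (n : ℝ) * (y - t - y) = -(n * t) by ring, Real.sin_neg, ← hs]
    ring
  have h3 : ∀ t, |K (y - t) - T (y - t)| = |Real.sin (n * t)| * |D (y - t)| := fun t => by
    rw [hD, show (n : ℝ) * (y - t - y) = -(n * t) by ring, Real.sin_neg, abs_mul, abs_neg]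
  simp only [h2, h3, integral_neg, abs_neg]
  rcases hsign with hs | hs
  · simp only [abs_of_nonneg (hs _)]
    rw [abs_of_nonneg (integral_nonneg fun t => mul_nonneg (abs_nonneg _) (hs _))]
  · simp only [abs_of_nonpos (hs _), mul_neg, integral_neg]
    rw [abs_of_nonpos (integral_nonpos fun t =>
      mul_nonpos_of_nonneg_of_nonpos (abs_nonneg _) (hs _))]

theorem abs_conv_le {R φ : ℝ → ℝ} (hR : Continuous R) (hp : Function.Periodic R (2 * Real.pi))
    (hφ : ∀ᵐ t ∂periodMeasure, |φ t| ≤ 1) (x : ℝ) :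
    |conv R φ x| ≤ 1 / Real.pi * ∫ t, |R t| ∂periodMeasure := by
  have hRp : Function.Periodic (fun t => |R t|) (2 * Real.pi) := fun t => by simp only [hp t]
  rw [conv_eq, abs_mul, abs_of_pos (by positivity : 0 < 1 / Real.pi),
    ← integral_comp_sub_of_periodic hRp x]
  refine mul_le_mul_of_nonneg_left ?_ (by positivity)
  refine norm_integral_le_of_norm_le (f := fun t => R (x - t) * φ t)
    (integrable_periodMeasure_of_continuous (f := fun t => |R (x - t)|) (by fun_prop)) ?_
  filter_upwards [hφ] with t ht
  rw [Real.norm_eq_abs, abs_mul]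
  exact mul_le_of_le_one_right (abs_nonneg _) ht

theorem normC_conv_signSin {K : ℝ → ℝ} (hK : Continuous K)
    (hp : Function.Periodic K (2 * Real.pi)) {n : ℕ} (hn : n ≠ 0) {y : ℝ} (h : HasNodes K n y) :
    normC (conv K (signSin n)) = ENNReal.ofReal |conv K (signSin n) y| := by
  obtain ⟨T, hT, hM⟩ := h.exists_norm_eq hK hp hn
  have hTc := continuous_of_mem_trigPoly hT
  have hTp := periodic_of_mem_trigPoly hT
  refine le_antisymm (iSup_le fun x => ?_) ?_
  · rw [← ofReal_norm, Real.norm_eq_abs, ← hM]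
    refine ENNReal.ofReal_le_ofReal ?_
    have h1 := conv_sub hK hp hTc hTp (integrable_signSin n) x
    rw [conv_trigPoly_signSin hn hT, sub_zero] at h1
    rw [← h1]
    exact abs_conv_le (hK.sub hTc) (hp.sub hTp) (Filter.Eventually.of_forall (abs_signSin_le n)) x
  · rw [← Real.norm_eq_abs, ofReal_norm]
    exact le_iSup (fun x => ‖conv K (signSin n) x‖ₑ) y

theorem bestApprox_normC_le {ψ : ℕ → ℝ} {β : ℝ} (hK : Continuous (kernel ψ β))
    (hp : Function.Periodic (kernel ψ β) (2 * Real.pi)) {n : ℕ} (hn : n ≠ 0) {y : ℝ}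
    (h : HasNodes (kernel ψ β) n y) :
    bestApprox normC (classC ψ β ⊤) n ≤ ENNReal.ofReal |conv (kernel ψ β) (signSin n) y| := by
  obtain ⟨T, hT, hM⟩ := h.exists_norm_eq hK hp hn
  have hTc := continuous_of_mem_trigPoly hT
  have hTp := periodic_of_mem_trigPoly hT
  refine iSup₂_le fun f ⟨A, φ, _, hφ, hφ1, _, hf⟩ => ?_
  have hφi : Integrable φ periodMeasure := hφ.integrable le_top
  refine (iInf₂_le _ (const_add_mem_trigPoly hn (conv_mem_trigPoly hT hφi) A)).trans ?_
  refine iSup_le fun x => ?_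
  beta_reduce
  rw [← ofReal_norm, Real.norm_eq_abs, ← hM, hf, add_sub_add_left_eq_sub,
    ← conv_sub hK hp hTc hTp hφi x]
  refine ENNReal.ofReal_le_ofReal (abs_conv_le (hK.sub hTc) (hp.sub hTp) ?_ x)
  rw [eLpNorm_exponent_top] at hφ1
  filter_upwards [ae_le_eLpNormEssSup (f := φ) (μ := periodMeasure)] with t ht
  have := ht.trans hφ1
  rw [← ofReal_norm, ENNReal.ofReal_le_one] at this
  exact this

theorem le_bestApprox_normC {ψ : ℕ → ℝ} {β : ℝ} (hK : Continuous (kernel ψ β))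
    (hp : Function.Periodic (kernel ψ β) (2 * Real.pi)) {n : ℕ} (hn : n ≠ 0) (y : ℝ) :
    ENNReal.ofReal |conv (kernel ψ β) (signSin n) y| ≤ bestApprox normC (classC ψ β ⊤) n := by
  refine le_trans ?_ (le_iSup₂ (f := fun f (_ : f ∈ classC ψ β ⊤) =>
    ⨅ T ∈ trigPoly n, normC fun x => f x - T x) _ (conv_signSin_mem_class hn))
  refine le_iInf₂ fun T hT => ?_
  set G := conv (kernel ψ β) (signSin n) with hG
  by_contra! hlt
  have hlt' : ∀ x, |G x - T x| < |G y| := fun x => by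
    have h1 := (le_iSup (fun x => ‖G x - T x‖ₑ) x).trans_lt hlt
    rw [← ofReal_norm, Real.norm_eq_abs] at h1
    exact (ENNReal.ofReal_lt_ofReal_iff_of_nonneg (abs_nonneg _)).1 h1
  -- The alternating sum annihilates `T`, whereas `G` contributes `G y` at each of the `2n` points.
  -- A uniform error below `|G y|` contradicts this.
  have h2 : altSum n (fun x => G x - T x) y = 2 * n * G y := by
    have h3 : altSum n (fun x => G x - T x) y = altSum n G y - altSum n T y := by
      unfold altSum
      rw [← Finset.sum_sub_distrib]
      exact Finset.sum_congr rfl fun j _ => by ring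
    rw [h3, altSum_trigPoly hn hT, sub_zero]
    unfold altSum
    rw [Finset.sum_congr rfl (g := fun _ => G y)]
    · simp
    · intro j _
      rw [hG, conv_signSin_shift_nat hK hp hn, ← mul_assoc, ← mul_pow]
      simp
  have h4 : |altSum n (fun x => G x - T x) y| < ∑ j ∈ Finset.range (2 * n), |G y| := by
    refine (Finset.abs_sum_le_sum_abs _ _).trans_lt ?_
    refine Finset.sum_lt_sum_of_nonempty (by simpa using hn) fun j _ => ?_
    rw [abs_mul, abs_pow, abs_neg, abs_one, one_pow, one_mul]
    exact hlt' _
  rw [h2, abs_mul] at h4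
  simp at h4

/-! ### Duality for a kernel with nodes: the integral metric -/

/-- This is Young's inequality for `(K - T) ∗ φ`: by Tonelli and periodicity its norm is at most
`(1/π) ‖K - T‖_1 ‖φ‖_1`. -/
theorem bestApprox_normL_le {ψ : ℕ → ℝ} {β : ℝ} (hK : Continuous (kernel ψ β))
    (hp : Function.Periodic (kernel ψ β) (2 * Real.pi)) {n : ℕ} (hn : n ≠ 0) {y : ℝ}
    (h : HasNodes (kernel ψ β) n y) :
    bestApprox normL (classC ψ β 1) n ≤ ENNReal.ofReal |conv (kernel ψ β) (signSin n) y| := by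
  obtain ⟨T, hT, hM⟩ := h.exists_norm_eq hK hp hn
  have hTc := continuous_of_mem_trigPoly hT
  have hTp := periodic_of_mem_trigPoly hT
  refine iSup₂_le fun f ⟨A, φ, _, hφ, hφ1, _, hf⟩ => ?_
  have hφi : Integrable φ periodMeasure := hφ.integrable le_rfl
  refine (iInf₂_le _ (const_add_mem_trigPoly hn (conv_mem_trigPoly hT hφi) A)).trans ?_
  set R := fun t => kernel ψ β t - T t with hR
  have hRc : Continuous R := hK.sub hTc
  have hRp : Function.Periodic R (2 * Real.pi) := hp.sub hTp
  have h1 : (fun x => f x - (A + conv T φ x)) = conv R φ := funext fun x => by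
    rw [hf, add_sub_add_left_eq_sub, ← conv_sub hK hp hTc hTp hφi x]
  rw [h1, normL, eLpNorm_one_eq_lintegral_enorm, ← hM]
  rw [eLpNorm_one_eq_lintegral_enorm] at hφ1
  have hRL : ∀ t, ∫⁻ x, ‖R (x - t)‖ₑ ∂periodMeasure =
      ENNReal.ofReal (∫ x, |R x| ∂periodMeasure) := fun t => by
    have h2 : Function.Periodic (fun t => |R t|) (2 * Real.pi) := fun t => by simp only [hRp t]
    rw [← integral_comp_sub_right_of_periodic h2 t, ofReal_integral_eq_lintegral_ofReal
      (integrable_periodMeasure_of_continuous (by fun_prop))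
      (Filter.Eventually.of_forall fun _ => abs_nonneg _)]
    simp only [← ofReal_norm, Real.norm_eq_abs]
  have h3 : ∀ x, ‖conv R φ x‖ₑ ≤
      ENNReal.ofReal (1 / Real.pi) * ∫⁻ t, ‖R (x - t)‖ₑ * ‖φ t‖ₑ ∂periodMeasure := fun x => by
    rw [conv_eq, enorm_mul, ← ofReal_norm (1 / Real.pi), Real.norm_eq_abs,
      abs_of_pos (by positivity : 0 < 1 / Real.pi)]
    gcongr
    simpa only [enorm_mul] using enorm_integral_le_lintegral_enorm (μ := periodMeasure)
      fun t => R (x - t) * φ t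
  refine (lintegral_mono h3).trans ?_
  rw [lintegral_const_mul' _ _ ENNReal.ofReal_ne_top, lintegral_lintegral_swap]
  · have h4 : ∀ t, ∫⁻ x, ‖R (x - t)‖ₑ * ‖φ t‖ₑ ∂periodMeasure =
        ENNReal.ofReal (∫ x, |R x| ∂periodMeasure) * ‖φ t‖ₑ := fun t => by
      rw [lintegral_mul_const' _ _ enorm_ne_top, hRL]
    simp only [h4]
    rw [lintegral_const_mul' _ _ ENNReal.ofReal_ne_top, ENNReal.ofReal_mul (by positivity)]
    exact mul_le_mul_right (mul_le_of_le_one_right (zero_le) hφ1) _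
  · have h5 : AEMeasurable (fun z : ℝ × ℝ => ‖φ z.2‖ₑ) (periodMeasure.prod periodMeasure) :=
      hφ.aestronglyMeasurable.enorm.comp_quasiMeasurePreserving
        Measure.quasiMeasurePreserving_snd
    have h6 : Measurable (fun z : ℝ × ℝ => ‖R (z.1 - z.2)‖ₑ) := by
      have : Continuous (fun z : ℝ × ℝ => R (z.1 - z.2)) := by fun_prop
      exact this.measurable.enorm
    exact h6.aemeasurable.mul h5

theorem signSin_neg (n : ℕ) (t : ℝ) : signSin n (-t) = -signSin n t := by
  unfold signSin
  rw [mul_neg, Real.sin_neg, Real.sign_neg]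

theorem integral_kernel_mul_signSin {K : ℝ → ℝ} (hp : Function.Periodic K (2 * Real.pi))
    (n : ℕ) (t : ℝ) :
    1 / Real.pi * ∫ x, K (x - t) * signSin n x ∂periodMeasure = -conv K (signSin n) (-t) := by
  have hg : Function.Periodic (fun u => K (-t - u) * signSin n u) (2 * Real.pi) := fun u => by
    simp only [signSin_periodic n u]
    rw [← hp (-t - (u + 2 * Real.pi))]
    congr 2; ring
  rw [conv_eq, ← integral_comp_sub_of_periodic hg 0, ← mul_neg, ← integral_neg]
  congr 2
  funext x
  rw [zero_sub, signSin_neg, show -t - -x = x - t by ring]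
  ring

/-- The sign of the function `G (-t)` where `|G (-t)|` exceeds `c`, and zero elsewhere. -/
def cutSign (G : ℝ → ℝ) (c t : ℝ) : ℝ :=
  if c < G (-t) then 1 else if G (-t) < -c then -1 else 0

theorem measurable_cutSign {G : ℝ → ℝ} (hG : Continuous G) (c : ℝ) :
    Measurable (cutSign G c) := by
  have hm : Measurable fun t : ℝ => G (-t) := by fun_prop
  exact Measurable.ite (measurableSet_lt measurable_const hm) measurable_const
    (Measurable.ite (measurableSet_lt hm measurable_const) measurable_const measurable_const)

theorem abs_cutSign_le (G : ℝ → ℝ) (c t : ℝ) : |cutSign G c t| ≤ 1 := by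
  unfold cutSign
  split_ifs <;> simp

theorem mul_abs_cutSign_le {G : ℝ → ℝ} {c : ℝ} (t : ℝ) :
    c * |cutSign G c t| ≤ cutSign G c t * G (-t) := by
  unfold cutSign
  split_ifs with h1 h2
  · simpa using h1.le
  · simp; linarith
  · simp

theorem cutSign_ne_zero {G : ℝ → ℝ} {c t : ℝ} (h : c < |G (-t)|) : cutSign G c t ≠ 0 := by
  unfold cutSign
  rcases lt_abs.1 h with h | h
  · rw [if_pos h]; norm_num
  · split_ifs with h1 h2
    · norm_num
    · norm_num
    · exact absurd (by linarith) h2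

theorem cutSign_of_neg {G : ℝ → ℝ} {c s t : ℝ} (hc : 0 ≤ c) (h : G (-s) = -G (-t)) :
    cutSign G c s = -cutSign G c t := by
  unfold cutSign
  rw [h]
  split_ifs <;> linarith

theorem integral_abs_cutSign_pos {G : ℝ → ℝ} (hG : Continuous G)
    (hp : Function.Periodic G (2 * Real.pi)) {c y : ℝ} (h : c < |G y|) :
    0 < ∫ t, |cutSign G c t| ∂periodMeasure := by
  have hp' : Function.Periodic (fun t => |cutSign G c t|) (2 * Real.pi) := fun t => by
    simp only [cutSign]
    rw [neg_add, ← sub_eq_add_neg, hp.sub_eq]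
  have hm := measurable_cutSign hG c
  rw [← integral_comp_sub_right_of_periodic hp' y, integral_pos_iff_support_of_nonneg
    (fun t => abs_nonneg _)]
  · have hU : IsOpen {t : ℝ | c < |G (-(t - y))|} := isOpen_lt continuous_const (by fun_prop)
    have hV := hU.inter (isOpen_Ioo (a := -Real.pi) (b := Real.pi))
    have hpos := hV.measure_pos volume ⟨0, by simpa using h, by constructor <;> linarith [Real.pi_pos]⟩
    refine hpos.trans_le ?_
    have hle : volume ({t : ℝ | c < |G (-(t - y))|} ∩ Ioo (-Real.pi) Real.pi) ≤
        periodMeasure {t : ℝ | c < |G (-(t - y))|} := by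
      unfold periodMeasure
      rw [Measure.restrict_apply hU.measurableSet]
      exact measure_mono (inter_subset_inter_right _ Ioo_subset_Ioc_self)
    refine hle.trans (measure_mono fun t ht => ?_)
    simpa using cutSign_ne_zero ht
  · refine Integrable.of_bound (C := 1) ?_ (Filter.Eventually.of_forall fun t => ?_)
    · have : Measurable fun t => |cutSign G c (t - y)| := by fun_prop
      exact this.aestronglyMeasurable
    · simpa using abs_cutSign_le G c _

/-- The error is tested against `φ_n`, which is bounded by one and orthogonal to `T`. Fubini moves
the kernel from `φ` to `φ_n`; the reflected argument and a minus sign come from the oddness of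
`φ_n`. -/
theorem le_normL_conv_sub {K φ : ℝ → ℝ} (hK : Continuous K)
    (hp : Function.Periodic K (2 * Real.pi)) {n : ℕ} (hn : n ≠ 0) {T : ℝ → ℝ}
    (hT : T ∈ trigPoly n) (hφ : Integrable φ periodMeasure) :
    ENNReal.ofReal (∫ t, φ t * conv K (signSin n) (-t) ∂periodMeasure) ≤
      normL (fun x => conv K φ x - T x) := by
  obtain ⟨C, hC⟩ := exists_bound_of_periodic hK hp
  have hint : Integrable (fun z : ℝ × ℝ => K (z.1 - z.2) * (signSin n z.1 * φ z.2))
      (periodMeasure.prod periodMeasure) := by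
    refine ((integrable_signSin n).mul_prod hφ).bdd_mul (c := C) ?_
      (Filter.Eventually.of_forall fun z => hC _)
    have : Continuous (fun z : ℝ × ℝ => K (z.1 - z.2)) := by fun_prop
    exact this.aestronglyMeasurable
  have hswap := integral_integral_swap
    (f := fun x t => K (x - t) * (signSin n x * φ t)) hint
  have hl : ∀ x, ∫ t, K (x - t) * (signSin n x * φ t) ∂periodMeasure =
      Real.pi * (conv K φ x * signSin n x) := fun x => by
    rw [conv_eq, ← mul_assoc, ← mul_assoc, mul_one_div_cancel Real.pi_ne_zero, one_mul,
      ← integral_mul_const]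
    congr 1
    funext t
    ring
  have hr : ∀ t, ∫ x, K (x - t) * (signSin n x * φ t) ∂periodMeasure =
      -(Real.pi * (φ t * conv K (signSin n) (-t))) := fun t => by
    have h1 := integral_kernel_mul_signSin hp n t
    have h2 : conv K (signSin n) (-t) =
        -(1 / Real.pi * ∫ x, K (x - t) * signSin n x ∂periodMeasure) := by rw [h1, neg_neg]
    have h3 : ∀ x, K (x - t) * (signSin n x * φ t) = (K (x - t) * signSin n x) * φ t :=
      fun x => by ring
    simp only [h3]
    rw [integral_mul_const, h2]
    field_simp
  simp only [hl, hr] at hswap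
  rw [integral_neg, integral_const_mul, integral_const_mul, ← mul_neg] at hswap
  have hmain := mul_left_cancel₀ Real.pi_ne_zero hswap
  have hfi : Integrable (fun x => conv K φ x * signSin n x) periodMeasure := by
    have := hint.integral_prod_left
    simp only [hl] at this
    exact (integrable_const_mul_iff (isUnit_iff_ne_zero.2 Real.pi_ne_zero) _).1 this
  have hTi : Integrable (fun x => T x * signSin n x) periodMeasure :=
    (intervalIntegrable_iff_integrableOn_Ioc_of_le (by linarith [Real.pi_pos])).1
      (intervalIntegrable_mul_signSin (continuous_of_mem_trigPoly hT) n (-Real.pi) Real.pi)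
  have h4 : ∫ x, (conv K φ x - T x) * signSin n x ∂periodMeasure =
      -∫ t, φ t * conv K (signSin n) (-t) ∂periodMeasure := by
    simp only [sub_mul]
    rw [integral_sub hfi hTi, integral_trigPoly_mul_signSin hn hT, sub_zero, hmain]
  rw [normL, eLpNorm_one_eq_lintegral_enorm]
  refine le_trans ?_ ((enorm_integral_le_lintegral_enorm
    (fun x => (conv K φ x - T x) * signSin n x)).trans (lintegral_mono fun x => ?_))
  · rw [h4, enorm_neg, ← ofReal_norm]
    exact ENNReal.ofReal_le_ofReal (le_abs_self _)
  · beta_reduce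
    rw [← ofReal_norm, ← ofReal_norm, norm_mul]
    exact ENNReal.ofReal_le_ofReal
      (mul_le_of_le_one_right (norm_nonneg _) (abs_signSin_le n x))

theorem le_bestApprox_normL {ψ : ℕ → ℝ} {β : ℝ} (hK : Continuous (kernel ψ β))
    (hp : Function.Periodic (kernel ψ β) (2 * Real.pi)) {n : ℕ} (hn : n ≠ 0) (y : ℝ) :
    ENNReal.ofReal |conv (kernel ψ β) (signSin n) y| ≤ bestApprox normL (classC ψ β 1) n := by
  set G := conv (kernel ψ β) (signSin n) with hG
  have hGc : Continuous G := continuous_conv_signSin hK hp hn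
  have hGp : Function.Periodic G (2 * Real.pi) := fun x => by
    have h1 := conv_signSin_shift_nat hK hp hn x (2 * n)
    have hn' : (n : ℝ) ≠ 0 := by exact_mod_cast hn
    rw [pow_mul, neg_one_sq, one_pow, one_mul] at h1
    rw [hG, ← h1]
    congr 1
    push_cast
    field_simp
  refine le_of_forall_lt fun a ha => ?_
  obtain ⟨b, hab, hb⟩ := exists_between ha
  refine hab.trans_le ?_
  obtain ⟨c, rfl⟩ : ∃ c : NNReal, b = c := ⟨b.toNNReal, (ENNReal.coe_toNNReal hb.ne_top).symm⟩
  have hc : (c : ℝ) < |G y| := by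
    rw [← ENNReal.ofReal_coe_nnreal] at hb
    exact (ENNReal.ofReal_lt_ofReal_iff_of_nonneg c.2).1 hb
  set w := cutSign G c with hw
  have hwm : Measurable w := measurable_cutSign hGc c
  have hW := integral_abs_cutSign_pos hGc hGp hc
  rw [← hw] at hW
  set W := ∫ t, |w t| ∂periodMeasure with hWdef
  have hwi : Integrable w periodMeasure :=
    Integrable.of_bound (C := 1) hwm.aestronglyMeasurable
      (Filter.Eventually.of_forall (abs_cutSign_le G c))
  have hwp : Function.Periodic w (2 * Real.pi) := fun t => by
    simp only [hw, cutSign]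
    rw [neg_add, ← sub_eq_add_neg, hGp.sub_eq]
  -- The admissible `φ` must have mean value zero: `G` is antiperiodic with shift `π/n`, and the cut
  -- function inherits this.
  have hw0 : ∫ t, w t ∂periodMeasure = 0 := by
    have h1 := integral_comp_sub_right_of_periodic hwp (Real.pi / n)
    have h2 : ∀ t, w (t - Real.pi / n) = -w t := fun t => by
      refine cutSign_of_neg c.2 ?_
      rw [← conv_signSin_shift hK hp hn (-t), neg_sub, sub_eq_add_neg, add_comm]
    simp only [h2, integral_neg] at h1
    linarith
  set φ := fun t => W⁻¹ * w t with hφ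
  have hφi : Integrable φ periodMeasure := hwi.const_mul _
  have hmem : conv (kernel ψ β) φ ∈ classC ψ β 1 := by
    refine ⟨0, φ, fun t => by simp only [hφ, hwp t], memLp_one_iff_integrable.2 hφi, ?_, ?_,
      by simp⟩
    · rw [eLpNorm_one_eq_lintegral_enorm, ← ofReal_integral_norm_eq_lintegral_enorm hφi,
        ENNReal.ofReal_le_one]
      simp only [hφ, norm_mul, Real.norm_eq_abs]
      rw [integral_const_mul, ← hWdef, abs_of_pos (inv_pos.2 hW), inv_mul_cancel₀ hW.ne']
    · rw [intervalIntegral_eq_integral_periodMeasure]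
      simp only [hφ]
      rw [integral_const_mul, hw0, mul_zero]
  refine le_trans ?_ (le_iSup₂ (f := fun f (_ : f ∈ classC ψ β 1) =>
    ⨅ T ∈ trigPoly n, normL fun x => f x - T x) _ hmem)
  refine le_iInf₂ fun T hT => le_trans ?_ (le_normL_conv_sub hK hp hn hT hφi)
  rw [← ENNReal.ofReal_coe_nnreal]
  refine ENNReal.ofReal_le_ofReal ?_
  simp only [hφ, mul_assoc]
  -- After multiplication by `W` the claim is the integral of the pointwise inequality `c |w(t)| ≤
  -- w(t) G(-t)`.
  rw [integral_const_mul, ← hG, ← div_eq_inv_mul, le_div_iff₀ hW, hWdef, ← integral_const_mul]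
  refine integral_mono (hwi.abs.const_mul _) ?_ fun t => mul_abs_cutSign_le t
  have hGi : Integrable (fun t => G (-t)) periodMeasure :=
    integrable_periodMeasure_of_continuous (by fun_prop)
  exact hGi.bdd_mul (c := 1) hwm.aestronglyMeasurable
    (Filter.Eventually.of_forall (abs_cutSign_le G c))

/-! ### Building trigonometric polynomials from powers of `e^{ix}` -/

theorem add_mem_trigPoly {n : ℕ} {S T : ℝ → ℝ} (hS : S ∈ trigPoly n) (hT : T ∈ trigPoly n) :
    (fun x => S x + T x) ∈ trigPoly n := by
  obtain ⟨a, b, hS⟩ := hS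
  obtain ⟨c, d, hT⟩ := hT
  refine ⟨a + c, b + d, fun x => ?_⟩
  beta_reduce
  rw [hS, hT, ← Finset.sum_add_distrib]
  exact Finset.sum_congr rfl fun k _ => by simp only [Pi.add_apply]; ring

theorem sum_mem_trigPoly {n : ℕ} {ι : Type*} (s : Finset ι) {T : ι → ℝ → ℝ}
    (hT : ∀ i ∈ s, T i ∈ trigPoly n) : (fun x => ∑ i ∈ s, T i x) ∈ trigPoly n := by
  classical
  induction s using Finset.induction_on with
  | empty => exact ⟨0, 0, by simp⟩
  | insert i s hi ih =>
    simp only [Finset.sum_insert hi]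
    exact add_mem_trigPoly (hT i (Finset.mem_insert_self i s))
      (ih fun j hj => hT j (Finset.mem_insert_of_mem hj))

theorem cos_add_sin_mem_trigPoly {n k : ℕ} (hk : k < n) (a b : ℝ) :
    (fun x => a * Real.cos (k * x) + b * Real.sin (k * x)) ∈ trigPoly n := by
  refine ⟨fun j => if j = k then a else 0, fun j => if j = k then b else 0, fun x => ?_⟩
  rw [Finset.sum_eq_single k]
  · simp
  · intro j _ hj
    simp [hj]
  · intro h
    exact absurd (Finset.mem_range.2 hk) h

theorem re_mul_exp_mem_trigPoly {n k : ℕ} (hk : k < n) (α : ℂ) :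
    (fun x : ℝ => (α * Complex.exp (x * Complex.I) ^ k).re) ∈ trigPoly n := by
  convert cos_add_sin_mem_trigPoly hk α.re (-α.im) using 2 with x
  rw [← Complex.exp_nat_mul, ← mul_assoc, show (k : ℂ) * (x : ℂ) = ((k * x : ℝ) : ℂ) by push_cast; rfl,
    Complex.mul_re, Complex.exp_ofReal_mul_I_re, Complex.exp_ofReal_mul_I_im]
  ring

theorem re_mul_exp_inv_mem_trigPoly {n k : ℕ} (hk : k < n) (α : ℂ) :
    (fun x : ℝ => (α * (Complex.exp (x * Complex.I) ^ k)⁻¹).re) ∈ trigPoly n := by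
  convert cos_add_sin_mem_trigPoly hk α.re α.im using 2 with x
  rw [← Complex.exp_nat_mul, ← Complex.exp_neg, ← mul_assoc,
    show -((k : ℂ) * (x : ℂ) * Complex.I) = ((-(k * x) : ℝ) : ℂ) * Complex.I by push_cast; ring,
    Complex.mul_re, Complex.exp_ofReal_mul_I_re, Complex.exp_ofReal_mul_I_im, Real.cos_neg,
    Real.sin_neg]
  ring

/-! ### Expansion of `1/cosh` and of the two series in powers of `e^{-h}` -/

theorem exp_neg_mem_Ioo {h : ℝ} (hh : 0 < h) : Real.exp (-h) ∈ Ioo (0 : ℝ) 1 :=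
  ⟨Real.exp_pos _, Real.exp_lt_one_iff.2 (by linarith)⟩

theorem sechCoeff_eq (h : ℝ) (k : ℕ) :
    sechCoeff h k = 2 * Real.exp (-h) ^ k / (1 + Real.exp (-h) ^ (2 * k)) := by
  have h1 : Real.exp (k * h) * Real.exp (-h) ^ k = 1 := by
    rw [← Real.exp_nat_mul, ← Real.exp_add]; simp
  have h2 : Real.exp (-(k * h)) = Real.exp (-h) ^ k := by
    rw [← Real.exp_nat_mul]; congr 1; ring
  rw [sechCoeff, Real.cosh_eq, h2, mul_comm 2 k, pow_mul]
  have hp : 0 < Real.exp (-h) ^ k := by positivity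
  have hp' := Real.exp_pos (k * h)
  field_simp
  linear_combination -h1

theorem hasSum_sechCoeff {h : ℝ} (hh : 0 < h) {k : ℕ} (hk : k ≠ 0) :
    HasSum (fun m : ℕ => 2 * (-1) ^ m * Real.exp (-h) ^ ((2 * m + 1) * k)) (sechCoeff h k) := by
  obtain ⟨h0, h1⟩ := exp_neg_mem_Ioo hh
  set q := Real.exp (-h) with hq
  have hlt : q ^ (2 * k) < 1 := pow_lt_one₀ h0.le h1 (by omega)
  have hg := (hasSum_geometric_of_abs_lt_one (r := -q ^ (2 * k)) (by
    rw [abs_neg, abs_of_pos (by positivity)]; exact hlt)).mul_left (2 * q ^ k)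
  rw [sub_neg_eq_add, ← div_eq_mul_inv] at hg
  rw [sechCoeff_eq, ← hq]
  refine hg.congr_fun fun m => Eq.symm ?_
  rw [neg_pow, ← pow_mul]
  ring

theorem norm_two_mul_neg_one_pow (m : ℕ) : ‖(2 * (-1) ^ m : ℂ)‖ = 2 := by simp

/-- Interchange of summation in the expansion of `1 / cosh` into odd powers of `exp (-h)`. -/
theorem hasSum_sech_interchange {h : ℝ} (hh : 0 < h) {κ : ℕ → ℕ} (hκ : ∀ i, i + 1 ≤ κ i)
    {e : ℕ → ℂ} (he : ∀ i, ‖e i‖ ≤ 1) {S : ℕ → ℂ}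
    (hS : ∀ m : ℕ, HasSum (fun i => ((Real.exp (-h) : ℂ) ^ (2 * m + 1)) ^ κ i * e i) (S m)) :
    HasSum (fun m => 2 * (-1) ^ m * S m) (∑' i, (sechCoeff h (κ i) : ℂ) * e i) := by
  obtain ⟨h0, h1⟩ := exp_neg_mem_Ioo hh
  obtain ⟨q, hq⟩ : ∃ q, q = Real.exp (-h) := ⟨_, rfl⟩
  rw [← hq] at h0 h1 hS
  obtain ⟨F, hF⟩ : ∃ F : ℕ × ℕ → ℂ, ∀ m i,
      F (m, i) = 2 * (-1) ^ m * (((q : ℂ) ^ (2 * m + 1)) ^ κ i * e i) :=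
    ⟨fun x => 2 * (-1) ^ x.1 * (((q : ℂ) ^ (2 * x.1 + 1)) ^ κ x.2 * e x.2), fun _ _ => rfl⟩
  have hsum : Summable F := by
    have hg := summable_geometric_of_lt_one h0.le h1
    have hb := ((hg.mul_of_nonneg hg (fun _ => pow_nonneg h0.le _)
      (fun _ => pow_nonneg h0.le _)).mul_left 2)
    refine Summable.of_norm_bounded hb fun x => ?_
    obtain ⟨m, i⟩ := x
    -- Since `(2m+1)(i+1) ≥ m + i`, the double series is dominated by a product of two geometric
    -- series.
    have h2 : q ^ ((2 * m + 1) * κ i) ≤ q ^ (m + i) := by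
      refine pow_le_pow_of_le_one h0.le h1.le ?_
      have := hκ i
      nlinarith
    calc ‖F (m, i)‖ = 2 * (q ^ ((2 * m + 1) * κ i) * ‖e i‖) := by
          rw [hF, norm_mul, norm_two_mul_neg_one_pow, norm_mul, ← pow_mul, norm_pow,
            Complex.norm_real, Real.norm_eq_abs, abs_of_pos h0]
      _ ≤ 2 * (q ^ (m + i) * 1) := by
          gcongr
          exact he _
      _ = 2 * (q ^ m * q ^ i) := by rw [pow_add, mul_one]
  have hrow : HasSum (fun m => 2 * (-1) ^ m * S m) (∑' x, F x) := by
    refine hsum.hasSum.prod_fiberwise fun m => ?_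
    simp only [hF]
    exact (hS m).mul_left _
  have hcol : HasSum (fun i => (sechCoeff h (κ i) : ℂ) * e i) (∑' x, F x) := by
    have hs : HasSum (fun x : ℕ × ℕ => F x.swap) (∑' x, F x) :=
      (Equiv.prodComm ℕ ℕ).hasSum_iff.2 hsum.hasSum
    refine hs.prod_fiberwise fun i => ?_
    have h3 := hasSum_sechCoeff hh (k := κ i) (by have := hκ i; omega)
    have h4 := (Complex.hasSum_ofReal.2 h3).mul_right (e i)
    refine h4.congr_fun fun m => Eq.symm ?_
    rw [Prod.swap_prod_mk, hF, ← hq]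
    push_cast
    rw [pow_mul]
    ring
  rw [hcol.tsum_eq]
  exact hrow

theorem norm_exp_ofReal_mul_I_pow (t : ℝ) (k : ℕ) :
    ‖Complex.exp (t * Complex.I) ^ k‖ = 1 := by
  rw [norm_pow, Complex.norm_exp_ofReal_mul_I, one_pow]

theorem re_exp_mul_tsum {a : ℕ → ℝ} (ha : Summable a) (ha0 : ∀ i, 0 ≤ a i) (κ : ℕ → ℕ)
    (t b : ℝ) :
    (Complex.exp ((-b : ℝ) * Complex.I) *
      ∑' i, (a i : ℂ) * Complex.exp (t * Complex.I) ^ κ i).re =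
      ∑' i, a i * Real.cos (κ i * t - b) := by
  have hs : Summable fun i => (a i : ℂ) * Complex.exp (t * Complex.I) ^ κ i := by
    refine Summable.of_norm_bounded ha fun i => ?_
    rw [norm_mul, norm_exp_ofReal_mul_I_pow, Complex.norm_real, mul_one, Real.norm_eq_abs,
      abs_of_nonneg (ha0 i)]
  rw [← tsum_mul_left, Complex.re_tsum (hs.mul_left _)]
  refine tsum_congr fun i => ?_
  rw [mul_left_comm, ← Complex.exp_nat_mul, ← Complex.exp_add, Complex.re_ofReal_mul,
    ← Complex.exp_ofReal_mul_I_re]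
  congr 3
  push_cast
  ring

theorem sechCoeff_nonneg (h : ℝ) (k : ℕ) : 0 ≤ sechCoeff h k :=
  div_nonneg zero_le_one (Real.cosh_pos _).le

theorem hasSum_kernelH {h : ℝ} (hh : 0 < h) (β t : ℝ) :
    ∃ Z : ℂ, Z.re = kernel (sechCoeff h) β t ∧
      HasSum (fun m : ℕ => Complex.exp ((-(β * Real.pi / 2) : ℝ) * Complex.I) * (2 * (-1) ^ m) *
        ((Real.exp (-h) : ℂ) ^ (2 * m + 1) * Complex.exp (t * Complex.I) /
          (1 - (Real.exp (-h) : ℂ) ^ (2 * m + 1) * Complex.exp (t * Complex.I)))) Z := by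
  obtain ⟨h0, h1⟩ := exp_neg_mem_Ioo hh
  have hS := hasSum_sech_interchange hh (κ := fun i => i + 1) (fun i => le_rfl)
    (e := fun i => Complex.exp (t * Complex.I) ^ (i + 1))
    (fun i => (norm_exp_ofReal_mul_I_pow t _).le)
    (S := fun m => (Real.exp (-h) : ℂ) ^ (2 * m + 1) * Complex.exp (t * Complex.I) /
          (1 - (Real.exp (-h) : ℂ) ^ (2 * m + 1) * Complex.exp (t * Complex.I))) (fun m => by
      have hn : ‖(Real.exp (-h) : ℂ) ^ (2 * m + 1) * Complex.exp (t * Complex.I)‖ < 1 := by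
        rw [norm_mul, Complex.norm_exp_ofReal_mul_I, mul_one, norm_pow, Complex.norm_real,
          Real.norm_eq_abs, abs_of_pos h0]
        exact pow_lt_one₀ h0.le h1 (by omega)
      have hg := (hasSum_geometric_of_norm_lt_one hn).mul_left
        ((Real.exp (-h) : ℂ) ^ (2 * m + 1) * Complex.exp (t * Complex.I))
      rw [← div_eq_mul_inv] at hg
      refine hg.congr_fun fun i => Eq.symm ?_
      ring)
  refine ⟨_, ?_, (hS.mul_left (Complex.exp ((-(β * Real.pi / 2) : ℝ) * Complex.I))).congr_fun
    fun m => mul_assoc _ _ _⟩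
  rw [re_exp_mul_tsum ((summable_nat_add_iff 1).2 (summable_sechCoeff hh))
      (fun i => sechCoeff_nonneg h _)]
  rfl

theorem summable_sechCoeff_odd {h : ℝ} (hh : 0 < h) {n : ℕ} (hn : n ≠ 0) :
    Summable fun ν : ℕ => sechCoeff h ((2 * ν + 1) * n) := by
  refine (summable_sechCoeff hh).comp_injective fun a b hab => ?_
  have := Nat.eq_of_mul_eq_mul_right (Nat.pos_of_ne_zero hn) hab
  omega

theorem thetaSeries_eq (h β : ℝ) (n : ℕ) (θ : ℝ) :
    thetaSeries h β n θ = ∑' ν : ℕ, sechCoeff h ((2 * ν + 1) * n) *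
      Real.cos ((2 * ν + 1 : ℕ) * (θ * Real.pi) - β * Real.pi / 2) := by
  unfold thetaSeries sechCoeff
  refine tsum_congr fun ν => ?_
  push_cast
  rw [← mul_assoc]

/-- Summation over `ν` first gives `p/(1 - p²)` with `p = q^{(2m+1)n} e^{iθπ}`. This is the
coefficient of the cosine of order `n` in the interpolation of the fraction with the same `m`. -/
theorem hasSum_thetaSeries {h : ℝ} (hh : 0 < h) (β : ℝ) {n : ℕ} (hn : n ≠ 0) (θ : ℝ) :
    ∃ Z : ℂ, Z.re = thetaSeries h β n θ ∧
      HasSum (fun m : ℕ => Complex.exp ((-(β * Real.pi / 2) : ℝ) * Complex.I) * (2 * (-1) ^ m) *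
        (((Real.exp (-h) : ℂ) ^ (2 * m + 1)) ^ n * Complex.exp ((θ * Real.pi : ℝ) * Complex.I) /
          (1 - (((Real.exp (-h) : ℂ) ^ (2 * m + 1)) ^ n *
            Complex.exp ((θ * Real.pi : ℝ) * Complex.I)) ^ 2))) Z := by
  obtain ⟨h0, h1⟩ := exp_neg_mem_Ioo hh
  set E := Complex.exp ((θ * Real.pi : ℝ) * Complex.I) with hE
  have hS := hasSum_sech_interchange hh (κ := fun i => (2 * i + 1) * n)
    (fun i => by have := Nat.pos_of_ne_zero hn; nlinarith)
    (e := fun i => E ^ (2 * i + 1))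
    (fun i => (norm_exp_ofReal_mul_I_pow _ _).le)
    (S := fun m => ((Real.exp (-h) : ℂ) ^ (2 * m + 1)) ^ n * E /
          (1 - (((Real.exp (-h) : ℂ) ^ (2 * m + 1)) ^ n * E) ^ 2)) (fun m => by
      have hn : ‖(((Real.exp (-h) : ℂ) ^ (2 * m + 1)) ^ n * E) ^ 2‖ < 1 := by
        rw [norm_pow, norm_mul, hE, Complex.norm_exp_ofReal_mul_I, mul_one, norm_pow, norm_pow, Complex.norm_real, Real.norm_eq_abs, abs_of_pos h0]
        rw [← pow_mul, ← pow_mul]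
        exact pow_lt_one₀ h0.le h1 (by positivity)
      have hg := (hasSum_geometric_of_norm_lt_one hn).mul_left
        (((Real.exp (-h) : ℂ) ^ (2 * m + 1)) ^ n * E)
      rw [← div_eq_mul_inv] at hg
      refine hg.congr_fun fun i => Eq.symm ?_
      rw [mul_comm (2 * i + 1) n, pow_mul, ← mul_pow, pow_succ, pow_mul]
      ring)
  refine ⟨_, ?_, (hS.mul_left (Complex.exp ((-(β * Real.pi / 2) : ℝ) * Complex.I))).congr_fun
    fun m => mul_assoc _ _ _⟩
  rw [re_exp_mul_tsum (summable_sechCoeff_odd hh hn) (fun i => sechCoeff_nonneg h _)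
      (fun i => 2 * i + 1), thetaSeries_eq]

/-! ### Interpolation of the kernel at the zeros of `sin(nt - θπ)` -/

theorem sum_pow_succ_eq {v : ℂ} (hv : v ≠ 1) (N : ℕ) :
    ∑ k ∈ Finset.range N, v ^ (k + 1) = (v - v ^ (N + 1)) / (1 - v) := by
  have h1 : v - 1 ≠ 0 := sub_ne_zero.2 hv
  have h2 : 1 - v ≠ 0 := sub_ne_zero.2 hv.symm
  simp only [pow_succ]
  rw [← Finset.sum_mul, geom_sum_eq hv]
  field_simp
  ring

/-- The interpolation of `v / (1 - v)`, `v = r z`, by trigonometric polynomials of degree `N + 1`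
at the `2 N + 2` zeros of `sin`, with its remainder. -/
theorem div_one_sub_eq_interpolation {r z E : ℂ} (hz : z ≠ 0) (hE : E ≠ 0) (N : ℕ)
    (hv : r * z ≠ 1) (hp : (r ^ (N + 1) * E) ^ 2 ≠ 1) :
    r * z / (1 - r * z) =
      ∑ k ∈ Finset.range N, r ^ (k + 1) / (1 - (r ^ (N + 1) * E) ^ 2) * z ^ (k + 1) +
      ∑ k ∈ Finset.range (N + 1),
        r ^ (2 * (N + 1) - k) * E ^ 2 / (1 - (r ^ (N + 1) * E) ^ 2) * (z ^ k)⁻¹ +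
      r ^ (N + 1) * E / (1 - (r ^ (N + 1) * E) ^ 2) * ((z ^ (N + 1) / E + E / z ^ (N + 1)) / 2) +
      r ^ (N + 1) * E / (1 - (r ^ (N + 1) * E) ^ 2) * ((1 + r * z) / (1 - r * z)) *
        ((z ^ (N + 1) / E - E / z ^ (N + 1)) / 2) := by
  have h1 : 1 - r * z ≠ 0 := sub_ne_zero.2 hv.symm
  have h2 : 1 - (r ^ (N + 1) * E) ^ 2 ≠ 0 := sub_ne_zero.2 hp.symm
  have s1 : ∑ k ∈ Finset.range N, r ^ (k + 1) / (1 - (r ^ (N + 1) * E) ^ 2) * z ^ (k + 1) =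
      (r * z - (r * z) ^ (N + 1)) / (1 - r * z) / (1 - (r ^ (N + 1) * E) ^ 2) := by
    rw [← sum_pow_succ_eq hv, Finset.sum_div]
    refine Finset.sum_congr rfl fun k _ => ?_
    rw [mul_pow]
    ring
  have s2 : ∑ k ∈ Finset.range (N + 1),
        r ^ (2 * (N + 1) - k) * E ^ 2 / (1 - (r ^ (N + 1) * E) ^ 2) * (z ^ k)⁻¹ =
      r ^ (N + 1) * E ^ 2 / z ^ (N + 1) *
        ((r * z - (r * z) ^ (N + 1 + 1)) / (1 - r * z)) / (1 - (r ^ (N + 1) * E) ^ 2) := by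
    rw [← sum_pow_succ_eq hv, Finset.mul_sum, Finset.sum_div, ← Finset.sum_range_reflect]
    refine Finset.sum_congr rfl fun j hj => ?_
    have hj' := Finset.mem_range.1 hj
    obtain ⟨i, hi⟩ : ∃ i, N = i + j := ⟨N - j, by omega⟩
    have e1 : N + 1 - 1 - j = i := by omega
    have e2 : 2 * (N + 1) - i = (N + 1) + (j + 1) := by omega
    have e3 : z ^ (N + 1) = z ^ i * z ^ (j + 1) := by rw [← pow_add]; congr 1; omega
    rw [e1, e2, e3, pow_add, mul_pow r z (j + 1)]
    field_simp
  rw [s1, s2]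
  have e1 : (r * z) ^ (N + 1 + 1) = r ^ (N + 1) * z ^ (N + 1) * (r * z) := by
    rw [pow_succ, mul_pow]
  have e2 : (r * z) ^ (N + 1) = r ^ (N + 1) * z ^ (N + 1) := mul_pow _ _ _
  rw [e1, e2]
  -- What remains is a rational identity in the independent quantities `P = z^n`, `p = r^n`, `v =
  -- rz` and `E`, with `n = N + 1`.
  have hP : z ^ (N + 1) ≠ 0 := pow_ne_zero _ hz
  generalize z ^ (N + 1) = P at *
  generalize r ^ (N + 1) = p at *
  generalize r * z = v at *
  rw [mul_pow] at h2 ⊢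
  field_simp
  ring

/-- The number `q ^ (2 m + 1)`, `q = exp (-h)`, as a complex number. -/
def oddPow (h : ℝ) (m : ℕ) : ℂ := (Real.exp (-h) : ℂ) ^ (2 * m + 1)

theorem norm_oddPow (h : ℝ) (m : ℕ) : ‖oddPow h m‖ = Real.exp (-h) ^ (2 * m + 1) := by
  rw [oddPow, norm_pow, Complex.norm_real, Real.norm_eq_abs, abs_of_pos (Real.exp_pos _)]

theorem norm_oddPow_le {h : ℝ} (hh : 0 < h) (m : ℕ) : ‖oddPow h m‖ ≤ Real.exp (-h) := by
  obtain ⟨h0, h1⟩ := exp_neg_mem_Ioo hh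
  rw [norm_oddPow]
  exact pow_le_of_le_one h0.le h1.le (by omega)

/-- The weight `2 (-1) ^ m exp (-i β π / 2)`. -/
def poleWeight (β : ℝ) (m : ℕ) : ℂ :=
  Complex.exp ((-(β * Real.pi / 2) : ℝ) * Complex.I) * (2 * (-1) ^ m)

theorem norm_poleWeight (β : ℝ) (m : ℕ) : ‖poleWeight β m‖ = 2 := by
  rw [poleWeight, norm_mul, Complex.norm_exp_ofReal_mul_I, norm_two_mul_neg_one_pow, one_mul]

/-- The number `q ^ ((2 m + 1) n) exp (i θ π)`. -/
def polePow (h : ℝ) (n : ℕ) (θ : ℝ) (m : ℕ) : ℂ :=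
  oddPow h m ^ n * Complex.exp ((θ * Real.pi : ℝ) * Complex.I)

theorem norm_polePow (h : ℝ) (n : ℕ) (θ : ℝ) (m : ℕ) :
    ‖polePow h n θ m‖ = (Real.exp (-h) ^ n) ^ (2 * m + 1) := by
  rw [polePow, norm_mul, Complex.norm_exp_ofReal_mul_I, mul_one, norm_pow, norm_oddPow,
    ← pow_mul, ← pow_mul, mul_comm]

/-- The coefficient of the remainder term which belongs to `q ^ (2 m + 1)`. -/
def poleCoeff (h β : ℝ) (n : ℕ) (θ : ℝ) (m : ℕ) : ℂ :=
  poleWeight β m * (polePow h n θ m / (1 - polePow h n θ m ^ 2))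

/-- The function `(1 + v) / (1 - v)` at `v = q ^ (2 m + 1) exp (i t)`. -/
def cayley (h : ℝ) (m : ℕ) (t : ℝ) : ℂ :=
  (1 + oddPow h m * Complex.exp (t * Complex.I)) / (1 - oddPow h m * Complex.exp (t * Complex.I))

/-- The factor of `sin (n t - θ π)` in the remainder of the interpolation of the kernel. -/
def nodeFactor (h β : ℝ) (n : ℕ) (θ t : ℝ) : ℝ :=
  -(∑' m, poleCoeff h β n θ m * cayley h m t).im

theorem norm_oddPow_mul_exp_le {h : ℝ} (hh : 0 < h) (m : ℕ) (t : ℝ) :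
    ‖oddPow h m * Complex.exp (t * Complex.I)‖ ≤ Real.exp (-h) := by
  rw [norm_mul, Complex.norm_exp_ofReal_mul_I, mul_one]
  exact norm_oddPow_le hh m

theorem one_sub_le_norm_one_sub {v : ℂ} {q : ℝ} (hv : ‖v‖ ≤ q) : 1 - q ≤ ‖1 - v‖ := by
  have := norm_sub_norm_le (1 : ℂ) v
  rw [norm_one] at this
  linarith

theorem norm_cayley_le {h : ℝ} (hh : 0 < h) (m : ℕ) (t : ℝ) :
    ‖cayley h m t‖ ≤ (1 + Real.exp (-h)) / (1 - Real.exp (-h)) := by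
  obtain ⟨h0, h1⟩ := exp_neg_mem_Ioo hh
  have hv := norm_oddPow_mul_exp_le hh m t
  rw [cayley, norm_div]
  have h2 := one_sub_le_norm_one_sub hv
  have h3 : ‖1 + oddPow h m * Complex.exp (t * Complex.I)‖ ≤ 1 + Real.exp (-h) := by
    refine (norm_add_le _ _).trans ?_
    rw [norm_one]
    linarith
  exact div_le_div₀ (by linarith) h3 (by linarith) h2

theorem norm_polePow_le {h : ℝ} (hh : 0 < h) (n : ℕ) (θ : ℝ) (m : ℕ) :
    ‖polePow h n θ m‖ ≤ Real.exp (-h) ^ n := by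
  obtain ⟨h0, h1⟩ := exp_neg_mem_Ioo hh
  rw [norm_polePow]
  exact pow_le_of_le_one (by positivity) (pow_le_one₀ h0.le h1.le) (by omega)

theorem one_sub_le_norm_one_sub_polePow_sq {h : ℝ} (hh : 0 < h) (n : ℕ) (θ : ℝ) (m : ℕ) :
    1 - (Real.exp (-h) ^ n) ^ 2 ≤ ‖1 - polePow h n θ m ^ 2‖ := by
  refine one_sub_le_norm_one_sub ?_
  rw [norm_pow]
  exact pow_le_pow_left₀ (norm_nonneg _) (norm_polePow_le hh n θ m) 2

theorem exp_pow_sq_lt_one {h : ℝ} (hh : 0 < h) {n : ℕ} (hn : n ≠ 0) :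
    (Real.exp (-h) ^ n) ^ 2 < 1 := by
  obtain ⟨h0, h1⟩ := exp_neg_mem_Ioo hh
  exact pow_lt_one₀ (by positivity) (pow_lt_one₀ h0.le h1 hn) (by norm_num)

theorem summable_oddPow_mul {h : ℝ} (hh : 0 < h) (β : ℝ) {j : ℕ} (hj : j ≠ 0) {x : ℕ → ℂ} {C : ℝ}
    (hx : ∀ m, ‖x m‖ ≤ C) : Summable fun m => poleWeight β m * (oddPow h m ^ j * x m) := by
  obtain ⟨h0, h1⟩ := exp_neg_mem_Ioo hh
  refine Summable.of_norm_bounded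
    ((summable_geometric_of_lt_one h0.le h1).mul_right (2 * C)) fun m => ?_
  rw [norm_mul, norm_mul, norm_poleWeight, norm_pow, norm_oddPow, ← pow_mul]
  have h2 : Real.exp (-h) ^ ((2 * m + 1) * j) ≤ Real.exp (-h) ^ m := by
    refine pow_le_pow_of_le_one h0.le h1.le ?_
    have : 1 ≤ j := by omega
    nlinarith
  have hC := (norm_nonneg _).trans (hx m)
  calc 2 * (Real.exp (-h) ^ ((2 * m + 1) * j) * ‖x m‖)
      ≤ 2 * (Real.exp (-h) ^ m * C) := by
        gcongr
        exact hx m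
    _ = Real.exp (-h) ^ m * (2 * C) := by ring

theorem norm_inv_one_sub_polePow_sq_le {h : ℝ} (hh : 0 < h) {n : ℕ} (hn : n ≠ 0) (θ : ℝ) (m : ℕ) :
    ‖(1 - polePow h n θ m ^ 2)⁻¹‖ ≤ (1 - (Real.exp (-h) ^ n) ^ 2)⁻¹ := by
  rw [norm_inv]
  exact inv_anti₀ (sub_pos.2 (exp_pow_sq_lt_one hh hn)) (one_sub_le_norm_one_sub_polePow_sq hh n θ m)

theorem summable_poleCoeff_mul {h : ℝ} (hh : 0 < h) (β : ℝ) {n : ℕ} (hn : n ≠ 0) (θ : ℝ)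
    {x : ℕ → ℂ} {C : ℝ} (hx : ∀ m, ‖x m‖ ≤ C) :
    Summable fun m => poleCoeff h β n θ m * x m := by
  have h1 := summable_oddPow_mul hh β hn
    (x := fun m => Complex.exp ((θ * Real.pi : ℝ) * Complex.I) * (1 - polePow h n θ m ^ 2)⁻¹ * x m)
    (C := (1 - (Real.exp (-h) ^ n) ^ 2)⁻¹ * C) (fun m => by
      rw [norm_mul, norm_mul, Complex.norm_exp_ofReal_mul_I, one_mul]
      exact mul_le_mul (norm_inv_one_sub_polePow_sq_le hh hn θ m) (hx m) (norm_nonneg _)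
        ((norm_nonneg _).trans (norm_inv_one_sub_polePow_sq_le hh hn θ m)))
  refine h1.congr fun m => ?_
  rw [poleCoeff, div_eq_mul_inv]
  generalize (1 - polePow h n θ m ^ 2)⁻¹ = d
  rw [polePow]
  ring

/-- The interpolation identities are summed over `m` with the weights `poleWeight`. The cosine of
order `n` is real, so only the real part of its total coefficient counts, and that is `thetaSeries`,
zero by assumption. -/
theorem exists_kernel_sub_eq {h : ℝ} (hh : 0 < h) (β : ℝ) {n : ℕ} (hn : n ≠ 0) {θ : ℝ}
    (hθ : thetaSeries h β n θ = 0) :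
    ∃ T ∈ trigPoly n, ∀ t, kernel (sechCoeff h) β t - T t =
      Real.sin (n * (t - θ * Real.pi / n)) * nodeFactor h β n θ t := by
  obtain ⟨N, rfl⟩ := Nat.exists_eq_succ_of_ne_zero hn
  rw [Nat.succ_eq_add_one] at *
  obtain ⟨h0, h1⟩ := exp_neg_mem_Ioo hh
  obtain ⟨U, hU0, hU⟩ := hasSum_thetaSeries hh β hn θ
  rw [hθ] at hU0
  set E := Complex.exp ((θ * Real.pi : ℝ) * Complex.I) with hE
  have hA : ∀ k, Summable fun m => poleWeight β m *
      (oddPow h m ^ (k + 1) * (1 - polePow h (N + 1) θ m ^ 2)⁻¹) := fun k =>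
    summable_oddPow_mul hh β (Nat.succ_ne_zero k) (norm_inv_one_sub_polePow_sq_le hh hn θ)
  have hB : ∀ k ∈ Finset.range (N + 1), Summable fun m => poleWeight β m *
      (oddPow h m ^ (2 * (N + 1) - k) * (E ^ 2 * (1 - polePow h (N + 1) θ m ^ 2)⁻¹)) := fun k hk =>
    summable_oddPow_mul hh β (by have := Finset.mem_range.1 hk; omega)
      (C := (1 - (Real.exp (-h) ^ (N + 1)) ^ 2)⁻¹) (fun m => by
        rw [norm_mul, norm_exp_ofReal_mul_I_pow, one_mul]
        exact norm_inv_one_sub_polePow_sq_le hh hn θ m)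
  set A : ℕ → ℂ := fun k => ∑' m, poleWeight β m *
      (oddPow h m ^ (k + 1) * (1 - polePow h (N + 1) θ m ^ 2)⁻¹)
  set B : ℕ → ℂ := fun k => ∑' m, poleWeight β m *
      (oddPow h m ^ (2 * (N + 1) - k) * (E ^ 2 * (1 - polePow h (N + 1) θ m ^ 2)⁻¹))
  refine ⟨fun t => ∑ k ∈ Finset.range N, (A k * Complex.exp (t * Complex.I) ^ (k + 1)).re +
      ∑ k ∈ Finset.range (N + 1), (B k * (Complex.exp (t * Complex.I) ^ k)⁻¹).re,
    add_mem_trigPoly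
      (sum_mem_trigPoly _ fun k hk => re_mul_exp_mem_trigPoly
        (by have := Finset.mem_range.1 hk; omega) _)
      (sum_mem_trigPoly _ fun k hk => re_mul_exp_inv_mem_trigPoly (Finset.mem_range.1 hk) _),
    fun t => ?_⟩
  obtain ⟨Z, hZ0, hZ⟩ := hasSum_kernelH hh β t
  set z := Complex.exp (t * Complex.I) with hz
  have hV := (summable_poleCoeff_mul hh β hn θ (fun m => norm_cayley_le hh m t)).hasSum
  set τ := ((N + 1 : ℕ) : ℝ) * (t - θ * Real.pi / (N + 1 : ℕ)) with hτ
  have hE0 : E ≠ 0 := Complex.exp_ne_zero _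
  have hz0 : z ≠ 0 := Complex.exp_ne_zero _
  have hP : z ^ (N + 1) / E = Complex.exp (τ * Complex.I) := by
    have : ((N : ℂ) + 1) ≠ 0 := by exact_mod_cast hn
    rw [hz, hE, ← Complex.exp_nat_mul, ← Complex.exp_sub, hτ]
    congr 1
    push_cast
    field_simp
  have hP' : E / z ^ (N + 1) = Complex.exp (-(τ * Complex.I)) := by
    rw [Complex.exp_neg, ← hP, inv_div]
  have hcos : (z ^ (N + 1) / E + E / z ^ (N + 1)) / 2 = (Real.cos τ : ℂ) := by
    rw [hP, hP', Complex.ofReal_cos, Complex.cos, neg_mul]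
  have hsin : (z ^ (N + 1) / E - E / z ^ (N + 1)) / 2 = (Real.sin τ : ℂ) * Complex.I := by
    rw [hP, hP', Complex.ofReal_sin, Complex.sin, neg_mul]
    linear_combination ((Complex.exp (τ * Complex.I) - Complex.exp (-(τ * Complex.I))) / 2) *
      Complex.I_mul_I
  have hsum := (((hasSum_sum fun k (_ : k ∈ Finset.range N) =>
      ((hA k).hasSum.mul_right (z ^ (k + 1)))).add
    (hasSum_sum fun k hk => ((hB k hk).hasSum.mul_right ((z ^ k)⁻¹)))).add
    (hU.mul_right (Real.cos τ : ℂ))).add (hV.mul_right ((Real.sin τ : ℂ) * Complex.I))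
  have hZ' := hsum.congr_fun (g := fun m : ℕ =>
      Complex.exp ((-(β * Real.pi / 2) : ℝ) * Complex.I) * (2 * (-1) ^ m) *
        ((Real.exp (-h) : ℂ) ^ (2 * m + 1) * z / (1 - (Real.exp (-h) : ℂ) ^ (2 * m + 1) * z)))
      (fun m => by
    have hv1 : oddPow h m * z ≠ 1 := fun hc => by
      have := norm_oddPow_mul_exp_le hh m t
      rw [← hz, hc, norm_one] at this
      linarith
    have hp1 : (oddPow h m ^ (N + 1) * E) ^ 2 ≠ 1 := fun hc => by
      have h2 := one_sub_le_norm_one_sub_polePow_sq hh (N + 1) θ m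
      have h3 := exp_pow_sq_lt_one hh hn
      rw [polePow, ← hE, hc, sub_self, norm_zero] at h2
      linarith
    have key := div_one_sub_eq_interpolation hz0 hE0 N hv1 hp1
    rw [hcos, hsin] at key
    change poleWeight β m * (oddPow h m * z / (1 - oddPow h m * z)) = _
    rw [key, mul_add, mul_add, mul_add, Finset.mul_sum, Finset.mul_sum]
    congr 1
    · congr 1
      · congr 1
        · refine Finset.sum_congr rfl fun k _ => ?_
          rw [polePow]
          ring
        · refine Finset.sum_congr rfl fun k _ => ?_
          rw [polePow]
          ring
      · change _ = poleWeight β m * (oddPow h m ^ (N + 1) * E /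
          (1 - (oddPow h m ^ (N + 1) * E) ^ 2)) * _
        ring
    · rw [poleCoeff, polePow, cayley]
      ring)
  have hfin := congrArg Complex.re (hZ.unique hZ')
  rw [hZ0, Complex.add_re, Complex.add_re, Complex.add_re, Complex.re_sum, Complex.re_sum,
    Complex.re_mul_ofReal, hU0, zero_mul, add_zero] at hfin
  -- The sine enters with a factor `i`, so its real coefficient is minus an imaginary part; hence
  -- the sign in `nodeFactor`.
  rw [hfin, add_sub_cancel_left, nodeFactor, ← mul_assoc, Complex.mul_I_re, Complex.im_mul_ofReal]
  ring

/-! ### Constant sign of the remainder factor -/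

/-- The real part is `(1 - q²)/|1 - v|²` and the imaginary part `2 Im v/|1 - v|²`, with `|1 - v| ≤ 1
+ q` and `|Im v| ≤ q`. -/
theorem cayley_bounds {v : ℂ} {q : ℝ} (hv : ‖v‖ = q) (hq : q < 1) :
    (1 - q) / (1 + q) ≤ ((1 + v) / (1 - v)).re ∧
      |((1 + v) / (1 - v)).im| ≤ 2 * q / (1 - q ^ 2) * ((1 + v) / (1 - v)).re := by
  have hq0 : 0 ≤ q := hv ▸ norm_nonneg v
  have hsq : v.re ^ 2 + v.im ^ 2 = q ^ 2 := by
    rw [← hv, Complex.sq_norm, Complex.normSq_apply]; ring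
  have hre := abs_le.1 (hv ▸ Complex.abs_re_le_norm v)
  have him := hv ▸ Complex.abs_im_le_norm v
  obtain ⟨N, hN⟩ : ∃ N, N = Complex.normSq (1 - v) := ⟨_, rfl⟩
  have hN1 : N = (1 - v.re) ^ 2 + v.im ^ 2 := by
    rw [hN, Complex.normSq_apply]; simp; ring
  have hN0 : 0 < N := by nlinarith
  have hNle : N ≤ (1 + q) ^ 2 := by nlinarith
  have h1 : ((1 + v) / (1 - v)).re = (1 - q ^ 2) / N := by
    rw [Complex.div_re, ← hN, ← hsq]
    simp only [Complex.add_re, Complex.one_re, Complex.sub_re, Complex.add_im, Complex.one_im,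
      Complex.sub_im]
    field_simp
    ring
  have h2 : ((1 + v) / (1 - v)).im = 2 * v.im / N := by
    rw [Complex.div_im, ← hN]
    simp only [Complex.add_re, Complex.one_re, Complex.sub_re, Complex.add_im, Complex.one_im,
      Complex.sub_im]
    field_simp
    ring
  have h3 : 0 < 1 - q ^ 2 := by nlinarith
  rw [h1, h2]
  constructor
  · rw [div_le_div_iff₀ (by linarith) hN0]
    nlinarith
  · have h4 : 2 * q / (1 - q ^ 2) * ((1 - q ^ 2) / N) = 2 * q / N := by field_simp
    rw [h4, abs_div, abs_of_pos hN0, abs_mul, abs_two]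
    gcongr

/-- Here `x + iy` plays the leading coefficient, `R + iI` the value of `(1+v)/(1-v)`, and `e` the
tail. In `1 + κ + ρ²` the `1` pays for passing from `|x| + |y|` to `|y|`, `κ` for the product `x I`,
and `ρ²` for the tail, since `ρ ≤ ρ² R`. -/
theorem abs_add_le_of_dominated {x e I R y B n₀ ρ κ : ℝ} (hx : |x| ≤ B) (hn : n₀ ≤ |x| + |y|)
    (he : |e| ≤ B * ρ) (hρ : 0 < ρ) (hR : ρ⁻¹ ≤ R) (hI : |I| ≤ κ * R)
    (hdom : B * (1 + κ + ρ ^ 2) ≤ n₀) : |x * I + e| ≤ |y| * R := by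
  have hB : 0 ≤ B := (abs_nonneg x).trans hx
  have hR0 : 0 < R := (inv_pos.2 hρ).trans_le hR
  have h1 : |x * I| ≤ B * (κ * R) := by
    rw [abs_mul]
    exact mul_le_mul hx hI (abs_nonneg _) hB
  have h2 : ρ ≤ ρ ^ 2 * R := by
    have : ρ ^ 2 * ρ⁻¹ ≤ ρ ^ 2 * R := by gcongr
    calc ρ = ρ ^ 2 * ρ⁻¹ := by field_simp
      _ ≤ _ := this
  have h3 : B * ρ ≤ B * (ρ ^ 2 * R) := by gcongr
  have h4 : B * (κ + ρ ^ 2) * R ≤ |y| * R := by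
    gcongr
    linarith
  calc |x * I + e| ≤ |x * I| + |e| := abs_add_le _ _
    _ ≤ B * (κ * R) + B * (ρ ^ 2 * R) := by linarith
    _ = B * (κ + ρ ^ 2) * R := by ring
    _ ≤ _ := h4

/-- This supplies the domination hypothesis of `abs_add_le_of_dominated`, with `κ = 2q/(1-q²)` and
`ρ = (1+q)/(1-q)`. The first bound on `Q²` is shaped to cancel the denominators of `1 + κ + ρ²`. -/
theorem tail_dominated {q Q : ℝ} (hq0 : 0 < q) (hq1 : q < 1) (hQ0 : 0 < Q)
    (hQ : Q ^ 2 ≤ (1 - q) ^ 2 * (1 - q ^ 2) / 4) (hQ8 : Q ^ 2 ≤ 1 / 8) :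
    2 * Q ^ 3 / (1 - Q ^ 2) ^ 2 * (1 + 2 * q / (1 - q ^ 2) + ((1 + q) / (1 - q)) ^ 2) ≤
      2 * Q / (1 + Q ^ 2) := by
  have h1 : 0 < 1 - q := by linarith
  have h2 : 0 < 1 - q ^ 2 := by nlinarith
  have hX : Q ^ 2 * (1 + 2 * q / (1 - q ^ 2) + ((1 + q) / (1 - q)) ^ 2) ≤ 3 / 5 := by
    have hX0 : 0 ≤ 1 + 2 * q / (1 - q ^ 2) + ((1 + q) / (1 - q)) ^ 2 := by positivity
    refine (mul_le_mul_of_nonneg_right hQ hX0).trans ?_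
    have : (1 - q) ^ 2 * (1 - q ^ 2) / 4 *
        (1 + 2 * q / (1 - q ^ 2) + ((1 + q) / (1 - q)) ^ 2) =
        ((1 - q) ^ 2 * (1 - q ^ 2) + 2 * q * (1 - q) ^ 2 + (1 + q) ^ 2 * (1 - q ^ 2)) / 4 := by
      field_simp
    rw [this]
    -- The numerator is `2 - 2q⁴ + 2q(1-q)²`. The last term is largest at `q = 1/3`, with value
    -- `8/27`, so the quotient stays below `3/5`.
    nlinarith [sq_nonneg (3 * q - 1), sq_nonneg (q ^ 2), mul_pos hq0 h1, sq_nonneg (q - 1 / 3),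
      mul_nonneg hq0.le (sq_nonneg (3 * q - 1))]
  have h3 : 0 < 1 - Q ^ 2 := by linarith
  have h4 : Q ^ 2 * (1 + 2 * q / (1 - q ^ 2) + ((1 + q) / (1 - q)) ^ 2) * (1 + Q ^ 2) ≤
      (1 - Q ^ 2) ^ 2 := by
    have : (3 / 5 : ℝ) * (1 + Q ^ 2) ≤ (1 - Q ^ 2) ^ 2 := by nlinarith
    exact (mul_le_mul_of_nonneg_right hX (by positivity)).trans this
  rw [div_mul_eq_mul_div, div_le_div_iff₀ (by positivity) (by positivity)]
  have h5 := mul_le_mul_of_nonneg_left h4 (by positivity : 0 ≤ 2 * Q)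
  calc _ = 2 * Q * (Q ^ 2 * (1 + 2 * q / (1 - q ^ 2) + ((1 + q) / (1 - q)) ^ 2) * (1 + Q ^ 2)) := by
        ring
    _ ≤ _ := h5

/-- The bounds for `q = exp (-h)` and `n` on which the whole argument depends. -/
structure Admissible (h : ℝ) (n : ℕ) : Prop where
  pos : 0 < h
  ne_zero : n ≠ 0
  sq_le : (Real.exp (-h) ^ n) ^ 2 ≤ (1 - Real.exp (-h)) ^ 2 * (1 - Real.exp (-h) ^ 2) / 4
  sq_le' : (Real.exp (-h) ^ n) ^ 2 ≤ 1 / 8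

theorem norm_poleCoeff_succ_le {h : ℝ} (hh : 0 < h) (β : ℝ) {n : ℕ} (hn : n ≠ 0) (θ : ℝ) (m : ℕ) :
    ‖poleCoeff h β n θ (m + 1)‖ ≤ 2 * (Real.exp (-h) ^ n) ^ 3 / (1 - (Real.exp (-h) ^ n) ^ 2) *
      ((Real.exp (-h) ^ n) ^ 2) ^ m := by
  rw [poleCoeff, norm_mul, norm_poleWeight, norm_div, norm_polePow]
  have h1 := one_sub_le_norm_one_sub_polePow_sq hh n θ (m + 1)
  have h2 := exp_pow_sq_lt_one hh hn
  have h3 : 0 < Real.exp (-h) ^ n := by positivity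
  set Q := Real.exp (-h) ^ n
  calc 2 * (Q ^ (2 * (m + 1) + 1) / ‖1 - polePow h n θ (m + 1) ^ 2‖)
      ≤ 2 * (Q ^ (2 * (m + 1) + 1) / (1 - Q ^ 2)) := by
        gcongr
    _ = _ := by ring

theorem le_norm_poleCoeff_zero {h : ℝ} (hh : 0 < h) (β : ℝ) {n : ℕ} (hn : n ≠ 0) (θ : ℝ) :
    2 * Real.exp (-h) ^ n / (1 + (Real.exp (-h) ^ n) ^ 2) ≤ ‖poleCoeff h β n θ 0‖ := by
  have hp := norm_polePow h n θ 0
  rw [mul_zero, zero_add, pow_one] at hp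
  have h1 : ‖1 - polePow h n θ 0 ^ 2‖ ≤ 1 + (Real.exp (-h) ^ n) ^ 2 := by
    refine (norm_sub_le _ _).trans ?_
    rw [norm_one, norm_pow, hp]
  have h2 : 0 < ‖1 - polePow h n θ 0 ^ 2‖ :=
    (sub_pos.2 (exp_pow_sq_lt_one hh hn)).trans_le (one_sub_le_norm_one_sub_polePow_sq hh n θ 0)
  rw [poleCoeff, norm_mul, norm_poleWeight, norm_div, hp, mul_div_assoc]
  gcongr

theorem nodeFactor_sign {h : ℝ} {n : ℕ} (hadm : Admissible h n) (β : ℝ) {θ : ℝ}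
    (hθ : thetaSeries h β n θ = 0) :
    (∀ t, 0 ≤ nodeFactor h β n θ t) ∨ ∀ t, nodeFactor h β n θ t ≤ 0 := by
  have hh := hadm.pos
  have hn := hadm.ne_zero
  obtain ⟨h0, h1⟩ := exp_neg_mem_Ioo hh
  have hQ1 := exp_pow_sq_lt_one hh hn
  have hb1 := norm_poleCoeff_succ_le hh β hn θ
  have hb0 := le_norm_poleCoeff_zero hh β hn θ
  have hQ0 : 0 < Real.exp (-h) ^ n := by positivity
  have hdom := tail_dominated h0 h1 hQ0 hadm.sq_le hadm.sq_le'
  have hsc : ∀ t, Summable fun m => poleCoeff h β n θ m * cayley h m t := fun t =>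
    summable_poleCoeff_mul hh β hn θ (fun m => norm_cayley_le hh m t)
  have hs : Summable (poleCoeff h β n θ) := by
    simpa using summable_poleCoeff_mul hh β hn θ (x := fun _ => 1) (C := 1) (by simp)
  obtain ⟨U, hU0, hU⟩ := hasSum_thetaSeries hh β hn θ
  replace hU : HasSum (poleCoeff h β n θ) U := hU
  rw [hθ, ← hU.tsum_eq, hs.tsum_eq_zero_add, Complex.add_re] at hU0
  set q := Real.exp (-h)
  set Q := q ^ n
  set B := 2 * Q ^ 3 / (1 - Q ^ 2) ^ 2 with hB
  have hgeo : HasSum (fun m : ℕ => 2 * Q ^ 3 / (1 - Q ^ 2) * (Q ^ 2) ^ m) B := by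
    have := (hasSum_geometric_of_lt_one (by positivity) hQ1).mul_left (2 * Q ^ 3 / (1 - Q ^ 2))
    rw [← div_eq_mul_inv, div_div, ← sq] at this
    exact this
  have hx : |(poleCoeff h β n θ 0).re| ≤ B := by
    -- The root equation states that the real parts of all coefficients sum to zero.
    have h2 : (poleCoeff h β n θ 0).re = -(∑' m, poleCoeff h β n θ (m + 1)).re := by linarith
    rw [h2, abs_neg]
    exact (Complex.abs_re_le_norm _).trans (tsum_of_norm_bounded hgeo hb1)
  have hmain : ∀ t, |(poleCoeff h β n θ 0).re * (cayley h 0 t).im +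
      (∑' m, poleCoeff h β n θ (m + 1) * cayley h (m + 1) t).im| ≤
      |(poleCoeff h β n θ 0).im| * (cayley h 0 t).re := fun t => by
    have hc := cayley_bounds (v := oddPow h 0 * Complex.exp (t * Complex.I)) (q := q) (by
      rw [norm_mul, Complex.norm_exp_ofReal_mul_I, norm_oddPow]
      simp [q]) h1
    refine abs_add_le_of_dominated hx (hb0.trans (Complex.norm_le_abs_re_add_abs_im _)) ?_
      (by have : 0 < 1 - q := by linarith
          positivity : 0 < (1 + q) / (1 - q)) (by rw [inv_div]; exact hc.1) hc.2 hdom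
    refine (Complex.abs_im_le_norm _).trans (tsum_of_norm_bounded
      (hgeo.mul_right ((1 + q) / (1 - q))) fun m => ?_)
    rw [norm_mul]
    exact mul_le_mul (hb1 m) (norm_cayley_le hh _ t) (norm_nonneg _)
      ((norm_nonneg _).trans (hb1 m))
  have hD : ∀ t, nodeFactor h β n θ t = -((poleCoeff h β n θ 0).im * (cayley h 0 t).re +
      ((poleCoeff h β n θ 0).re * (cayley h 0 t).im +
      (∑' m, poleCoeff h β n θ (m + 1) * cayley h (m + 1) t).im)) := fun t => by
    rw [nodeFactor, (hsc t).tsum_eq_zero_add, Complex.add_im, Complex.mul_im]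
    ring
  rcases le_total (poleCoeff h β n θ 0).im 0 with hy | hy
  · left
    intro t
    have := abs_le.1 (hmain t)
    rw [abs_of_nonpos hy] at this
    rw [hD]
    linarith
  · right
    intro t
    have := abs_le.1 (hmain t)
    rw [abs_of_nonneg hy] at this
    rw [hD]
    linarith

theorem hasNodes_kernel {h : ℝ} {n : ℕ} (hadm : Admissible h n) (β : ℝ) {θ : ℝ}
    (hθ : thetaSeries h β n θ = 0) :
    HasNodes (kernel (sechCoeff h) β) n (θ * Real.pi / n) := by
  obtain ⟨T, hT, hTD⟩ := exists_kernel_sub_eq hadm.pos β hadm.ne_zero hθ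
  exact ⟨T, hT, nodeFactor h β n θ, hTD, nodeFactor_sign hadm β hθ⟩

/-! ### From the threshold to the bounds on `Q²` -/

theorem admissible_of_nStar_le {h : ℝ} (hh : 0 < h) {n : ℕ} (hn : nStar h ≤ n) :
    Admissible h n := by
  obtain ⟨h0, h1⟩ := exp_neg_mem_Ioo hh
  have key : n ≠ 0 ∧ (Real.exp (-h) ^ n) ^ 2 ≤
      (1 - Real.exp (-h)) ^ 2 * (1 - Real.exp (-h) ^ 2) / 4 := by
    unfold nStar at hn
    split_ifs at hn with hlog
    · have hq : Real.exp (-h) ≤ 3 / 10 := by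
        rw [Real.exp_neg, ← inv_div, ← Real.exp_log (by norm_num : (0 : ℝ) < 10 / 3)]
        exact inv_anti₀ (Real.exp_pos _) (Real.exp_le_exp.2 hlog)
      refine ⟨by omega, ?_⟩
      have h2 : Real.exp (-h) ^ n ≤ Real.exp (-h) := pow_le_of_le_one h0.le h1.le (by omega)
      have h3 := pow_le_pow_left₀ (by positivity) h2 2
      generalize Real.exp (-h) = q at *
      -- For `q ≤ 3/10` already `n = 1` suffices: `0.09 < 0.49 · 0.91 / 4`.
      have h4 : q ^ 2 ≤ 9 / 100 := by nlinarith
      have h5 : (49 / 100 : ℝ) ≤ (1 - q) ^ 2 := by nlinarith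
      nlinarith
    · have hmem : 1 ≤ nStarStar h ∧ thresholdIneq h (nStarStar h) :=
        Nat.sInf_mem (s := {n : ℕ | 1 ≤ n ∧ thresholdIneq h n}) (exists_thresholdIneq hh)
      obtain ⟨hm1, hm⟩ := hmem
      refine ⟨by omega, ?_⟩
      generalize nStarStar h = k at *
      have he2 : Real.exp (-2 * h) = Real.exp (-h) ^ 2 := by
        rw [← Real.exp_nat_mul]; congr 1; push_cast; ring
      unfold thresholdIneq at hm
      rw [he2] at hm
      have hpos := Real.exp_pos (-2 * k * h)
      generalize Real.exp (-2 * k * h) = s at *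
      generalize Real.exp (-h) = q at *
      have hq2 : q ^ 2 < 1 := by nlinarith
      -- Because `q ≤ (1 + q²)/2`, the power in the threshold dominates `Q²`. Of the rest only `5 +
      -- 3q² ≥ 4`, the square root being at most one, and positivity of the last summand are needed.
      have h2 : (q ^ n) ^ 2 ≤ ((1 + q ^ 2) / 2) ^ (2 * k) := by
        calc (q ^ n) ^ 2 ≤ (q ^ k) ^ 2 :=
              pow_le_pow_left₀ (by positivity) (pow_le_pow_of_le_one h0.le h1.le hn) 2
          _ = q ^ (2 * k) := by rw [← pow_mul, mul_comm]
          _ ≤ _ := pow_le_pow_left₀ h0.le (by nlinarith [sq_nonneg (1 - q)]) _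
      have hr0 : 0 < ((1 + q ^ 2) / 2) ^ (2 * k) := by positivity
      have hr1 : ((1 + q ^ 2) / 2) ^ (2 * k) < 1 :=
        pow_lt_one₀ (by positivity) (by linarith) (by omega)
      generalize ((1 + q ^ 2) / 2) ^ (2 * k) = r at *
      have hs0 : 0 < Real.sqrt (1 - r) := Real.sqrt_pos.2 (by linarith)
      have hs1 : Real.sqrt (1 - r) ≤ 1 := Real.sqrt_le_one.2 (by linarith)
      have h3 : r ≤ r / Real.sqrt (1 - r) := le_div_self hr0.le hs0 hs1
      have h4 : (5 + 3 * q ^ 2) / (1 - q ^ 2) * r ≤ (1 - q) ^ 2 := by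
        have : 0 < (5 + 3 * q ^ 2) / (1 - q ^ 2) := div_pos (by positivity) (by linarith)
        have := mul_le_mul_of_nonneg_left h3 this.le
        have : 0 < (2 + s) * s := by positivity
        linarith
      rw [div_mul_eq_mul_div, div_le_iff₀ (by linarith)] at h4
      nlinarith
  refine ⟨hh, key.1, key.2, ?_⟩
  have h2 : Real.exp (-h) ^ n ≤ Real.exp (-h) := pow_le_of_le_one h0.le h1.le key.1
  have h3 := pow_le_pow_left₀ (by positivity) h2 2
  have h4 := key.2
  generalize (Real.exp (-h) ^ n) ^ 2 = s at *
  generalize Real.exp (-h) = q at *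
  -- For `q ≤ 1/3` one has `Q² ≤ q² ≤ 1/9`; otherwise the first bound gives `Q² ≤ (1-q)²/4 ≤ 1/9`.
  rcases le_total q (1 / 3) with hq | hq
  · nlinarith
  · have h5 : (1 - q) ^ 2 ≤ 4 / 9 := by nlinarith
    nlinarith

/-! ### Existence and uniqueness of the root `θ` -/

theorem abs_sin_odd_mul_le (ν : ℕ) (δ : ℝ) :
    |Real.sin ((2 * ν + 1 : ℕ) * δ)| ≤ (2 * ν + 1) * |Real.sin δ| := by
  have h : ∀ k : ℕ, |Real.sin (k * δ)| ≤ k * |Real.sin δ| := fun k => by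
    induction k with
    | zero => simp
    | succ k ih =>
      have e : ((k + 1 : ℕ) : ℝ) * δ = k * δ + δ := by push_cast; ring
      rw [e, Real.sin_add]
      refine (abs_add_le _ _).trans ?_
      rw [abs_mul, abs_mul]
      push_cast
      have h1 := mul_le_of_le_one_right (abs_nonneg (Real.sin (k * δ))) (Real.abs_cos_le_one δ)
      have h2 := mul_le_of_le_one_left (abs_nonneg (Real.sin δ)) (Real.abs_cos_le_one (k * δ))
      linarith
  simpa using h (2 * ν + 1)

theorem abs_cos_odd_mul_le (ν : ℕ) (δ : ℝ) :
    |Real.cos ((2 * ν + 1 : ℕ) * δ)| ≤ (2 * ν + 1) * |Real.cos δ| := by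
  have h := abs_sin_odd_mul_le ν (δ + Real.pi / 2)
  rw [Real.sin_add_pi_div_two] at h
  have e : ((2 * ν + 1 : ℕ) : ℝ) * (δ + Real.pi / 2) =
      (2 * ν + 1 : ℕ) * δ + Real.pi / 2 + ν * Real.pi := by push_cast; ring
  rwa [e, Real.sin_add_nat_mul_pi, abs_mul, abs_pow, abs_neg, abs_one, one_pow, one_mul,
    Real.sin_add_pi_div_two] at h

theorem sechCoeff_odd_le {h : ℝ} (n ν : ℕ) :
    sechCoeff h ((2 * ν + 1) * n) ≤ 2 * (Real.exp (-h) ^ n) ^ (2 * ν + 1) := by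
  rw [sechCoeff_eq, ← pow_mul, mul_comm n]
  have : 0 < Real.exp (-h) ^ (2 * ((2 * ν + 1) * n)) := by positivity
  exact div_le_self (by positivity) (by linarith)

/-- The first term must balance the tail, which is small against it. The common factor `d` cancels,
so the bound is uniform as `d` tends to zero, that is, as two roots approach each other. With `Q² ≤
1/8` the quotient `3Q²(1+Q²)/(1-3Q²)` is at most `27/40`. -/
theorem abs_le_of_tsum_eq_zero {h : ℝ} {n : ℕ} (hadm : Admissible h n) {x : ℕ → ℝ} {s d : ℝ}
    (hd : 0 < d) (hx0 : x 0 = s * d) (hx : ∀ ν : ℕ, |x ν| ≤ (2 * ν + 1) * d)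
    (hs : Summable fun ν => sechCoeff h ((2 * ν + 1) * n) * x ν)
    (h0 : ∑' ν, sechCoeff h ((2 * ν + 1) * n) * x ν = 0) : |s| ≤ 27 / 40 := by
  rw [hs.tsum_eq_zero_add, hx0, mul_zero, zero_add, one_mul] at h0
  have hQ8 := hadm.sq_le'
  have ha : sechCoeff h n = 2 * Real.exp (-h) ^ n / (1 + (Real.exp (-h) ^ n) ^ 2) := by
    rw [sechCoeff_eq, ← pow_mul, mul_comm n]
  have hQ0 : 0 < Real.exp (-h) ^ n := by positivity
  have hle := sechCoeff_odd_le (h := h) n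
  set Q := Real.exp (-h) ^ n
  have h3 : 3 * Q ^ 2 < 1 := by linarith
  have hg := (hasSum_geometric_of_lt_one (by positivity) h3).mul_left (6 * Q ^ 3 * d)
  have hb : ‖∑' ν : ℕ, sechCoeff h ((2 * (ν + 1) + 1) * n) * x (ν + 1)‖ ≤
      6 * Q ^ 3 * d * (1 - 3 * Q ^ 2)⁻¹ := by
    refine tsum_of_norm_bounded hg fun ν => ?_
    rw [norm_mul, Real.norm_eq_abs, Real.norm_eq_abs, abs_of_nonneg (sechCoeff_nonneg h _)]
    -- Bernoulli's inequality turns the growth `2ν + 3` into a geometric factor, so the majorant has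
    -- ratio `3Q²`.
    have h4 : (2 * ((ν + 1 : ℕ) : ℝ) + 1) ≤ 3 ^ (ν + 1) := by
      have := one_add_mul_le_pow (by norm_num : (-2 : ℝ) ≤ 2) (ν + 1)
      norm_num at this ⊢
      linarith
    calc sechCoeff h ((2 * (ν + 1) + 1) * n) * |x (ν + 1)|
        ≤ 2 * Q ^ (2 * (ν + 1) + 1) * (3 ^ (ν + 1) * d) := by
          refine mul_le_mul (hle (ν + 1)) ((hx (ν + 1)).trans ?_) (abs_nonneg _) (by positivity)
          gcongr
      _ = _ := by
          rw [mul_pow, ← pow_mul]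
          ring
  rw [Real.norm_eq_abs, ← abs_neg, ← eq_neg_of_add_eq_zero_left h0, abs_mul, abs_mul,
    abs_of_nonneg (sechCoeff_nonneg h n), abs_of_pos hd, ha] at hb
  have h5 : |s| ≤ 3 * Q ^ 2 * (1 + Q ^ 2) / (1 - 3 * Q ^ 2) := by
    rw [le_div_iff₀ (by linarith)]
    rw [← div_eq_mul_inv, le_div_iff₀ (by linarith), div_mul_eq_mul_div, div_mul_eq_mul_div,
      div_le_iff₀ (by positivity)] at hb
    have h6 : 0 < 2 * Q * d := by positivity
    refine le_of_mul_le_mul_left ?_ h6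
    linarith
  refine h5.trans ?_
  rw [div_le_iff₀ (by linarith)]
  nlinarith

theorem summable_sechCoeff_odd_mul {h : ℝ} (hh : 0 < h) {n : ℕ} (hn : n ≠ 0) {x : ℕ → ℝ}
    (hx : ∀ ν, |x ν| ≤ 1) : Summable fun ν => sechCoeff h ((2 * ν + 1) * n) * x ν := by
  refine Summable.of_norm_bounded (summable_sechCoeff_odd hh hn) fun ν => ?_
  rw [norm_mul, Real.norm_eq_abs, Real.norm_eq_abs, abs_of_nonneg (sechCoeff_nonneg h _)]
  exact mul_le_of_le_one_right (sechCoeff_nonneg h _) (hx ν)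

/-- With midpoint `c` and half-distance `δ` of two roots, the sum and difference of the equations
separate the terms with `cos((2ν+1)δ)` from those with `sin((2ν+1)δ)`. Each relation forces its
leading factor, `cos(c-b)` or `sin(c-b)`, to be at most `27/40` in modulus; but `2 (27/40)² < 1`. -/
theorem thetaSeries_root_unique {h : ℝ} {n : ℕ} (hadm : Admissible h n) (β : ℝ) {θ₁ θ₂ : ℝ}
    (hlt : θ₁ < θ₂) (hlt' : θ₂ < θ₁ + 1) (h1 : thetaSeries h β n θ₁ = 0) :
    thetaSeries h β n θ₂ ≠ 0 := by
  intro h2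
  set b := β * Real.pi / 2 with hb
  set c := (θ₁ * Real.pi + θ₂ * Real.pi) / 2
  set δ := (θ₂ * Real.pi - θ₁ * Real.pi) / 2 with hδ
  have hpi := Real.pi_pos
  have hδ0 : 0 < δ := by rw [hδ]; nlinarith
  have hδ1 : δ < Real.pi / 2 := by rw [hδ]; nlinarith
  have hsin : 0 < Real.sin δ := Real.sin_pos_of_pos_of_lt_pi hδ0 (by linarith)
  have hcos : 0 < Real.cos δ := Real.cos_pos_of_mem_Ioo ⟨by linarith, hδ1⟩
  have e1 : ∀ ν : ℕ, Real.cos ((2 * ν + 1 : ℕ) * (θ₁ * Real.pi) - b) =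
      Real.cos ((2 * ν + 1 : ℕ) * c - b) * Real.cos ((2 * ν + 1 : ℕ) * δ) +
      Real.sin ((2 * ν + 1 : ℕ) * c - b) * Real.sin ((2 * ν + 1 : ℕ) * δ) := fun ν => by
    rw [← Real.cos_sub]
    congr 1
    simp only [c, δ]
    ring
  have e2 : ∀ ν : ℕ, Real.cos ((2 * ν + 1 : ℕ) * (θ₂ * Real.pi) - b) =
      Real.cos ((2 * ν + 1 : ℕ) * c - b) * Real.cos ((2 * ν + 1 : ℕ) * δ) -
      Real.sin ((2 * ν + 1 : ℕ) * c - b) * Real.sin ((2 * ν + 1 : ℕ) * δ) := fun ν => by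
    rw [← Real.cos_add]
    congr 1
    simp only [c, δ]
    ring
  rw [thetaSeries_eq] at h1 h2
  simp only [← hb, e1, e2] at h1 h2
  have hsC := summable_sechCoeff_odd_mul hadm.pos hadm.ne_zero
    (x := fun ν : ℕ => Real.cos ((2 * ν + 1 : ℕ) * c - b) * Real.cos ((2 * ν + 1 : ℕ) * δ))
    (fun ν => by
      rw [abs_mul]
      exact mul_le_one₀ (Real.abs_cos_le_one _) (abs_nonneg _) (Real.abs_cos_le_one _))
  have hsS := summable_sechCoeff_odd_mul hadm.pos hadm.ne_zero
    (x := fun ν : ℕ => Real.sin ((2 * ν + 1 : ℕ) * c - b) * Real.sin ((2 * ν + 1 : ℕ) * δ))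
    (fun ν => by
      rw [abs_mul]
      exact mul_le_one₀ (Real.abs_sin_le_one _) (abs_nonneg _) (Real.abs_sin_le_one _))
  simp only [mul_add] at h1
  simp only [mul_sub] at h2
  rw [hsC.tsum_add hsS] at h1
  rw [hsC.tsum_sub hsS] at h2
  have hC := abs_le_of_tsum_eq_zero hadm hcos (s := Real.cos (c - b)) (by simp)
    (fun ν => by
      rw [abs_mul]
      refine (mul_le_of_le_one_left (abs_nonneg _) (Real.abs_cos_le_one _)).trans ?_
      simpa only [abs_of_pos hcos] using abs_cos_odd_mul_le ν δ) hsC (by linarith)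
  have hS := abs_le_of_tsum_eq_zero hadm hsin (s := Real.sin (c - b)) (by simp)
    (fun ν => by
      rw [abs_mul]
      refine (mul_le_of_le_one_left (abs_nonneg _) (Real.abs_sin_le_one _)).trans ?_
      simpa only [abs_of_pos hsin] using abs_sin_odd_mul_le ν δ) hsS (by linarith)
  have hC2 := sq_le_sq' (by linarith [abs_nonneg (Real.cos (c - b))]) hC
  have hS2 := sq_le_sq' (by linarith [abs_nonneg (Real.sin (c - b))]) hS
  rw [sq_abs] at hC2 hS2
  have := Real.sin_sq_add_cos_sq (c - b)
  norm_num at hC2 hS2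
  linarith

theorem continuous_thetaSeries {h : ℝ} (hh : 0 < h) (β : ℝ) {n : ℕ} (hn : n ≠ 0) :
    Continuous (thetaSeries h β n) := by
  rw [funext (thetaSeries_eq h β n)]
  refine continuous_tsum (fun ν => by fun_prop) (summable_sechCoeff_odd hh hn) fun ν θ => ?_
  rw [norm_mul, Real.norm_eq_abs, Real.norm_eq_abs, abs_of_nonneg (sechCoeff_nonneg h _)]
  exact mul_le_of_le_one_right (sechCoeff_nonneg h _) (Real.abs_cos_le_one _)

theorem thetaSeries_add_one (h β : ℝ) (n : ℕ) (θ : ℝ) :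
    thetaSeries h β n (θ + 1) = -thetaSeries h β n θ := by
  rw [thetaSeries_eq, thetaSeries_eq, ← tsum_neg]
  refine tsum_congr fun ν => ?_
  have e : ((2 * ν + 1 : ℕ) : ℝ) * ((θ + 1) * Real.pi) - β * Real.pi / 2 =
      (2 * ν + 1 : ℕ) * (θ * Real.pi) - β * Real.pi / 2 + (2 * ν + 1 : ℕ) * Real.pi := by ring
  rw [e, Real.cos_add_nat_mul_pi, Odd.neg_one_pow ⟨ν, rfl⟩]
  ring

theorem exists_thetaSeries_eq_zero {h : ℝ} (hh : 0 < h) (β : ℝ) {n : ℕ} (hn : n ≠ 0) :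
    ∃ θ ∈ Ico (0 : ℝ) 1, thetaSeries h β n θ = 0 := by
  have h1 := thetaSeries_add_one h β n 0
  rw [zero_add] at h1
  have hc := (continuous_thetaSeries hh β hn).continuousOn (s := uIcc 0 1)
  have hz : (0 : ℝ) ∈ uIcc (thetaSeries h β n 0) (thetaSeries h β n 1) := by
    rw [h1, mem_uIcc]
    rcases le_total (thetaSeries h β n 0) 0 with h | h
    · left; constructor <;> linarith
    · right; constructor <;> linarith
  obtain ⟨θ, hθ, hθ0⟩ := intermediate_value_uIcc hc hz
  rw [uIcc_of_le zero_le_one] at hθ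
  rcases hθ.2.lt_or_eq with hlt | rfl
  · exact ⟨θ, ⟨hθ.1, hlt⟩, hθ0⟩
  -- A zero at the excluded endpoint `1` is also a zero at `0`, by antiperiodicity.
  · exact ⟨0, by simp, by linarith⟩

/-! ### The value of `K ∗ φ_n` at the node -/

theorem continuous_kernel_sech {h : ℝ} (hh : 0 < h) (β : ℝ) :
    Continuous (kernel (sechCoeff h) β) := by
  refine continuous_tsum (fun k => by fun_prop)
    ((summable_nat_add_iff 1).2 (summable_sechCoeff hh)) fun k t => ?_
  rw [norm_mul, Real.norm_eq_abs, Real.norm_eq_abs, abs_of_nonneg (sechCoeff_nonneg h _)]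
  exact mul_le_of_le_one_right (sechCoeff_nonneg h _) (Real.abs_cos_le_one _)

theorem periodic_kernel (ψ : ℕ → ℝ) (β : ℝ) : Function.Periodic (kernel ψ β) (2 * Real.pi) := by
  intro t
  refine tsum_congr fun k => ?_
  have e : ((k + 1 : ℕ) : ℝ) * (t + 2 * Real.pi) - β * Real.pi / 2 =
      (k + 1 : ℕ) * t - β * Real.pi / 2 + (k + 1 : ℕ) * (2 * Real.pi) := by ring
  rw [e, Real.cos_add_nat_mul_two_pi]

theorem hasSum_altSum_kernel {h : ℝ} (hh : 0 < h) (β : ℝ) {n : ℕ} (hn : n ≠ 0) (x : ℝ) :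
    HasSum (fun ν : ℕ => sechCoeff h ((2 * ν + 1) * n) *
      (2 * n * Real.cos (((2 * ν + 1) * n : ℕ) * x - β * Real.pi / 2)))
      (altSum n (kernel (sechCoeff h) β) x) := by
  have hs : ∀ t, HasSum (fun k : ℕ => sechCoeff h (k + 1) *
      Real.cos ((k + 1 : ℕ) * t - β * Real.pi / 2)) (kernel (sechCoeff h) β t) := fun t => by
    refine Summable.hasSum (Summable.of_norm_bounded
      ((summable_nat_add_iff 1).2 (summable_sechCoeff hh)) fun k => ?_)
    rw [norm_mul, Real.norm_eq_abs, Real.norm_eq_abs, abs_of_nonneg (sechCoeff_nonneg h _)]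
    exact mul_le_of_le_one_right (sechCoeff_nonneg h _) (Real.abs_cos_le_one _)
  have h1 : HasSum (fun k : ℕ => sechCoeff h (k + 1) *
      altSum n (fun t => Real.cos ((k + 1 : ℕ) * t - β * Real.pi / 2)) x)
      (altSum n (kernel (sechCoeff h) β) x) := by
    refine HasSum.congr_fun (hasSum_sum fun j (_ : j ∈ Finset.range (2 * n)) =>
      (hs (x + j * Real.pi / n)).mul_left ((-1) ^ j)) fun k => ?_
    rw [altSum, Finset.mul_sum]
    exact Finset.sum_congr rfl fun j _ => by ring
  have hnpos := Nat.pos_of_ne_zero hn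
  have hidx : ∀ ν : ℕ, (2 * ν + 1) * n - 1 + 1 = (2 * ν + 1) * n := fun ν =>
    Nat.sub_add_cancel (Nat.mul_pos (by omega) hnpos)
  -- The kernel series is indexed by `k + 1`, so the surviving frequencies `(2ν+1)n` sit at the
  -- indices `(2ν+1)n - 1`.
  have hinj : Function.Injective fun ν : ℕ => (2 * ν + 1) * n - 1 := fun a b hab => by
    have h2 : (2 * a + 1) * n = (2 * b + 1) * n := by
      rw [← hidx a, ← hidx b]
      exact congrArg (· + 1) hab
    have := Nat.eq_of_mul_eq_mul_right hnpos h2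
    omega
  have h2 := (hinj.hasSum_iff (fun k hk => by
    rw [altSum_cos_eq_zero n (k + 1) hn (fun ν hν => hk ⟨ν, by simp only [← hν]; omega⟩),
      mul_zero])).2 h1
  refine h2.congr_fun fun ν => ?_
  simp only [Function.comp_apply]
  rw [hidx, altSum_cos_of_odd_mul n ν hn]

theorem integral_cos_half_period (m n : ℕ) (hm : m ≠ 0) (hn : n ≠ 0) (hodd : ∃ ν, m = (2 * ν + 1) * n)
    (y b : ℝ) :
    ∫ t in (0 : ℝ)..(Real.pi / n), Real.cos (m * (y - t) - b) = 2 * Real.sin (m * y - b) / m := by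
  have hm' : (m : ℝ) ≠ 0 := by exact_mod_cast hm
  have hn' : (n : ℝ) ≠ 0 := by exact_mod_cast hn
  have hd : ∀ t ∈ uIcc (0 : ℝ) (Real.pi / n),
      HasDerivAt (fun t => -Real.sin (m * (y - t) - b) / m) (Real.cos (m * (y - t) - b)) t := by
    intro t _
    have h1 : HasDerivAt (fun t => m * (y - t) - b) (-(m : ℝ)) t := by
      simpa using (((hasDerivAt_id t).const_sub y).const_mul (m : ℝ)).sub_const b
    have h2 := (h1.sin.neg).div_const (m : ℝ)
    refine h2.congr_deriv ?_
    field_simp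
  rw [intervalIntegral.integral_eq_sub_of_hasDerivAt hd
    (Continuous.intervalIntegrable (by fun_prop) _ _)]
  obtain ⟨ν, hν⟩ := hodd
  have e : (m : ℝ) * (y - Real.pi / n) - b = m * y - b - (2 * ν + 1 : ℕ) * Real.pi := by
    rw [hν]
    push_cast
    field_simp
    ring
  rw [e, Real.sin_sub_nat_mul_pi, Odd.neg_one_pow ⟨ν, rfl⟩, sub_zero]
  ring

/-- Only the frequencies `(2ν+1)n` survive in the alternating sum. Each is integrated over `[0,
π/n]`, an odd number of its half-periods, which turns the cosine into twice the sine divided by the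
frequency. -/
theorem conv_kernel_signSin {h : ℝ} (hh : 0 < h) (β : ℝ) {n : ℕ} (hn : n ≠ 0) (θ : ℝ) :
    conv (kernel (sechCoeff h) β) (signSin n) (θ * Real.pi / n) =
      4 / Real.pi * valueSeries h β n θ := by
  have hn' : (n : ℝ) ≠ 0 := by exact_mod_cast hn
  set y := θ * Real.pi / n with hy
  set b := β * Real.pi / 2 with hb
  rw [conv_signSin (continuous_kernel_sech hh β) (periodic_kernel _ _) hn]
  set F : ℕ → C(ℝ, ℝ) := fun ν => ⟨fun t => sechCoeff h ((2 * ν + 1) * n) *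
      (2 * n * Real.cos (((2 * ν + 1) * n : ℕ) * (y - t) - b)), by fun_prop⟩ with hF
  have hsum : Summable fun ν => ‖(F ν).restrict
      (⟨uIcc 0 (Real.pi / n), isCompact_uIcc⟩ : TopologicalSpace.Compacts ℝ)‖ := by
    refine Summable.of_nonneg_of_le (fun _ => norm_nonneg _) (fun ν => ?_)
      ((summable_sechCoeff_odd hh hn).mul_right (2 * n : ℝ))
    refine (ContinuousMap.norm_le _
      (mul_nonneg (sechCoeff_nonneg h _) (by positivity))).2 fun t => ?_
    rw [ContinuousMap.restrict_apply]
    simp only [hF, ContinuousMap.coe_mk]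
    rw [norm_mul, norm_mul, Real.norm_of_nonneg (sechCoeff_nonneg h _),
      Real.norm_of_nonneg (by positivity : (0 : ℝ) ≤ 2 * n)]
    refine mul_le_mul_of_nonneg_left ?_ (sechCoeff_nonneg h _)
    exact mul_le_of_le_one_right (by positivity) (Real.abs_cos_le_one _)
  have hint := intervalIntegral.hasSum_intervalIntegral_of_summable_norm hsum
  have e1 : ∀ t, ∑' ν, F ν t = altSum n (kernel (sechCoeff h) β) (y - t) := fun t =>
    (hasSum_altSum_kernel hh β hn (y - t)).tsum_eq
  simp only [e1] at hint
  rw [← hint.tsum_eq, ← tsum_mul_left, valueSeries, ← tsum_mul_left]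
  refine tsum_congr fun ν => ?_
  simp only [hF, ContinuousMap.coe_mk]
  rw [intervalIntegral.integral_const_mul, intervalIntegral.integral_const_mul,
    integral_cos_half_period _ n (Nat.mul_ne_zero (by omega) hn) hn ⟨ν, rfl⟩, sechCoeff]
  have e2 : (((2 * ν + 1) * n : ℕ) : ℝ) * y = (2 * ν + 1) * θ * Real.pi := by
    rw [hy]
    push_cast
    field_simp
  rw [e2, ← hb]
  push_cast
  have hc := (Real.cosh_pos ((2 * ν + 1) * n * h)).ne'
  generalize Real.sin ((2 * ν + 1) * θ * Real.pi - b) = S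
  field_simp
  ring

end ConvApprox

end

theorem mainTheorem3 (h β : ℝ) (hh : 0 < h) (n : ℕ) (hn : ConvApprox.nStar h ≤ n) :
    ConvApprox.bestApprox ConvApprox.normC (ConvApprox.classCh h β ⊤) n =
        ConvApprox.bestApprox ConvApprox.normL (ConvApprox.classCh h β 1) n ∧
      ConvApprox.bestApprox ConvApprox.normL (ConvApprox.classCh h β 1) n =
        ConvApprox.normC (ConvApprox.conv (ConvApprox.kernelH h β) (ConvApprox.signSin n)) ∧
      ∃ θ : ℝ, θ ∈ Set.Ico (0 : ℝ) 1 ∧ ConvApprox.thetaSeries h β n θ = 0 ∧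
        (∀ θ' : ℝ, θ' ∈ Set.Ico (0 : ℝ) 1 → ConvApprox.thetaSeries h β n θ' = 0 → θ' = θ) ∧
        ConvApprox.normC (ConvApprox.conv (ConvApprox.kernelH h β) (ConvApprox.signSin n)) =
          ENNReal.ofReal (4 / Real.pi * |ConvApprox.valueSeries h β n θ|) := by
  have hadm := ConvApprox.admissible_of_nStar_le hh hn
  have hn0 := hadm.ne_zero
  have hK := ConvApprox.continuous_kernel_sech hh β
  have hp := ConvApprox.periodic_kernel (ConvApprox.sechCoeff h) β
  obtain ⟨θ, hθ, hθ0⟩ := ConvApprox.exists_thetaSeries_eq_zero hh β hn0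
  have hnodes := ConvApprox.hasNodes_kernel hadm β hθ0
  have hC := le_antisymm (ConvApprox.bestApprox_normC_le hK hp hn0 hnodes)
    (ConvApprox.le_bestApprox_normC hK hp hn0 _)
  have hL := le_antisymm (ConvApprox.bestApprox_normL_le hK hp hn0 hnodes)
    (ConvApprox.le_bestApprox_normL hK hp hn0 _)
  have hN := ConvApprox.normC_conv_signSin hK hp hn0 hnodes
  refine ⟨hC.trans hL.symm, hL.trans hN.symm, θ, hθ, hθ0, fun θ' hθ' hθ'0 => ?_, ?_⟩
  · rcases lt_trichotomy θ' θ with hlt | heq | hlt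
    · exact absurd hθ0 (ConvApprox.thetaSeries_root_unique hadm β hlt
        (by linarith [hθ.2, hθ'.1]) hθ'0)
    · exact heq
    · exact absurd hθ'0 (ConvApprox.thetaSeries_root_unique hadm β hlt
        (by linarith [hθ'.2, hθ.1]) hθ0)
  · rw [ConvApprox.conv_kernel_signSin hh β hn0, abs_mul,
      abs_of_pos (by positivity : 0 < 4 / Real.pi)] at hN
    exact hN
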